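/- Let $\operatorname{sign}(y)=1$ for $y\ge 0$ and $\operatorname{sign}(y)=-1$ for $y<0$, let $\alpha=2\pi/3$, and let $F:\mathbb R^2\to\mathbb R^2$ be the map $$F(x,y)=\begin{pmatrix}\cos\alpha&\sin\alpha\\-\sin\alpha&\cos\alpha\end{pmatrix}\begin{pmatrix}x-\operatorname{sign}(y)\\y\end{pmatrix}.$$ Its critical set $\mathcal F$ is the union of the sets $LC_{-i}=\{p: F^i(p)\in LC_0\}$, $i\ge 0$, where $LC_0=\{y=0\}$. Let $\mathcal F_{2\pi/3}$ be the trihexagonal grid formed by the lines $y=\sqrt3(x-2k)$, $y=\sqrt3\,\ell$, $y=-\sqrt3(x-2m-1)$ with $k,\ell,m\in\mathbb Z$, and $\mathcal U=\mathbb R^2\setminus\mathcal F_{2\pi/3}$. The tiles are the nonempty sets $$T_{k,\ell,m}=\{(x,y):\sqrt3(x-2k-2)<y<\sqrt3(x-2k),\ \sqrt3\,\ell<y<\sqrt3(\ell+1),\ -\sqrt3(x-2m+1)<y<-\sqrt3(x-2m-1)\}$$ with $k,\ell,m\in\mathbb Z$. With $B=\lfloor(3x-\sqrt3y)/6\rfloor$,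 $C=\lfloor\sqrt3y/3\rfloor$, $D=\lfloor(3x+\sqrt3y+3)/6\rfloor$ put $$V(x,y)=\max\big(|B-C+D|,\ |B+C+D+1|-1,\ |-B+C+D|\big).$$ A necklace of $M$ beads means here $M$ pairwise disjoint tiles, numbered by $i\in\mathbb Z_M$ in clockwise order around the origin (one turn), such that the closures of consecutive tiles have exactly one common point. Periods are minimal periods. Then: (i) $\mathcal F=\mathcal F_{2\pi/3}$, and the union of the $LC_{-i}$ with $i\ge1$ is also equal to $\mathcal F_{2\pi/3}$. (ii) $V$ is a first integral of $F$ on $\mathcal U$, that is, $F(\mathcal U)\subset\mathcal U$, $V\circ F=V$ on $\mathcal U$, and $V$ is not constant on $\mathcal U$; moreover $V(\mathcal U)=\mathbb N_0$. (a) For each even $c\in\mathbb N_0$ the level set $\{V=c\}\cap\mathcal U$ is a necklace of $6c+2$ open equilateral triangles. $F$ maps the $i$-th triangle onto the $(i+2c)$-th one and the center of the former to the center of the latter; so, if each triangle is identified with its center, $F$ on this level is conjugate to $h:\mathbb Z_{6c+2}\to\mathbb Z_{6c+2}$, $h(i)=i+2c$. Each of these triangles is invariant by $F^{3c+1}$,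 which restricted to it is a rotation of order $3$ about its center, and all its points but the center have period $9c+3$. (b) For each odd $c\in\mathbb N_0$ the level set $\{V=c\}\cap\mathcal U$ is a necklace of $3c+1$ open regular hexagons. $F$ maps the $i$-th hexagon onto the $(i+c)$-th one and the center of the former to the center of the latter; so, if each hexagon is identified with its center, $F$ on this level is conjugate to $h:\mathbb Z_{3c+1}\to\mathbb Z_{3c+1}$, $h(i)=i+c$. Each of these hexagons is invariant by $F^{3c+1}$, which restricted to it is a rotation of order $3$ about its center, and all its points but the center have period $9c+3$. (iii) Every point of $\mathcal F$ is periodic with period $9n+3$ for some $n\in\mathbb N_0$. (iv) $F$ is pointwise periodic, that is, it is bijective and every point is periodic, and its set of periods is $\operatorname{Per}(F)=\{3n+1: n\in\mathbb N_0\}\cup\{9n+3: n\in\mathbb N_0\}$. -/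

import Mathlib

open Real Set Function

noncomputable section

/-- The real plane. Only its topology and its vector space structure are used. -/
abbrev Plane : Type := ℝ × ℝ

/-- The sign with value `+1` at `0`, as in the definition of the map. -/
def sgn (y : ℝ) : ℝ := if 0 ≤ y then 1 else -1

/-- The linear map with matrix `[cos α, sin α; -sin α, cos α]`
(the clockwise rotation of angle `α` about the origin). -/
def rot (α : ℝ) (p : Plane) : Plane :=
  (cos α * p.1 + sin α * p.2, -sin α * p.1 + cos α * p.2)

/-- The piecewise affine map `F`, with parameter `α`. -/
def mapF (α : ℝ) (p : Plane) : Plane := rot α (p.1 - sgn p.2, p.2)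

/-- The critical line `LC_{-i}`: the points whose `i`-th iterate has second coordinate `0`. -/
def criticalLine (α : ℝ) (i : ℕ) : Set Plane := {p | ((mapF α)^[i] p).2 = 0}

/-- The critical set: the points whose orbit touches the discontinuity line `y = 0`. -/
def criticalSet (α : ℝ) : Set Plane := ⋃ i : ℕ, criticalLine α i

/-- The trihexagonal grid: the lines `y = √3 (x - 2k)`, `y = √3 ℓ`, `y = -√3 (x - 2m - 1)`. -/
def grid : Set Plane :=
  {p | (∃ k : ℤ, p.2 = √3 * (p.1 - 2 * k)) ∨ (∃ l : ℤ, p.2 = √3 * l) ∨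
    (∃ m : ℤ, p.2 = -√3 * (p.1 - 2 * m - 1))}

/-- The zero-free set: the complement of the grid. -/
def zeroFree : Set Plane := gridᶜ

/-- The open tile with labels `k, ℓ, m`. -/
def tile (k l m : ℤ) : Set Plane :=
  {p | (√3 * (p.1 - 2 * k - 2) < p.2 ∧ p.2 < √3 * (p.1 - 2 * k)) ∧
    (√3 * l < p.2 ∧ p.2 < √3 * (l + 1)) ∧
    (-√3 * (p.1 - 2 * m + 1) < p.2 ∧ p.2 < -√3 * (p.1 - 2 * m - 1))}

/-- The first label of a point. -/
def labelB (p : Plane) : ℤ := ⌊(3 * p.1 - √3 * p.2) / 6⌋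

/-- The second label of a point. -/
def labelC (p : Plane) : ℤ := ⌊√3 * p.2 / 3⌋

/-- The third label of a point. -/
def labelD (p : Plane) : ℤ := ⌊(3 * p.1 + √3 * p.2 + 3) / 6⌋

/-- The function `V` for `α = 2π/3`; its values are integers, seen as real numbers. -/
def funV (p : Plane) : ℝ :=
  ((max |labelB p - labelC p + labelD p|
    (max (|labelB p + labelC p + labelD p + 1| - 1)
      |-labelB p + labelC p + labelD p|) : ℤ) : ℝ)

/-- The part in the zero-free set of the energy level `c`. -/
def levelSet (c : ℕ) : Set Plane := {p | p ∈ zeroFree ∧ funV p = c}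

/-- `V` is a first integral of the map `f` on the set `U`: `U` is invariant, and `V` is
a real valued function, not constant on `U`, with `V ∘ f = V` on `U`. -/
def IsFirstIntegralOn (f : Plane → Plane) (U : Set Plane) (V : Plane → ℝ) : Prop :=
  MapsTo f U U ∧ (∀ p ∈ U, V (f p) = V p) ∧ ∃ p ∈ U, ∃ q ∈ U, V p ≠ V q

/-- `S` is an open regular polygon with `n` sides and center `x` (for `3 ≤ n`): the
intersection of the `n` open half-planes whose border lines are at distance `a > 0` from `x`
and whose outer unit normals make the angles `φ + 2πj/n`, `j = 0, …, n - 1`, with the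
first axis. -/
def IsOpenRegularPolygon (n : ℕ) (S : Set Plane) (x : Plane) : Prop :=
  ∃ a φ : ℝ, 0 < a ∧
    S = {p | ∀ j : Fin n, cos (φ + 2 * π * (j : ℕ) / n) * (p.1 - x.1) +
      sin (φ + 2 * π * (j : ℕ) / n) * (p.2 - x.2) < a}

/-- On the set `S`, the map `f` is a rotation of order `q` about the point `x`. -/
def IsRotationOfOrderOn (f : Plane → Plane) (S : Set Plane) (x : Plane) (q : ℕ) : Prop :=
  ∃ θ : ℝ, (∀ p ∈ S, f p = x + rot θ (p - x)) ∧ addOrderOf (θ : Real.Angle) = q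

/-- The beads `T i`, with centers `x i`, form a necklace around the origin, numbered in
clockwise order: the beads are pairwise disjoint, the closures of two consecutive beads
have exactly one common point, and the centers have polar angles which strictly decrease
along `0, 1, …, n - 1`, within one turn. -/
structure IsClockwiseNecklace (n : ℕ) (T : ZMod n → Set Plane) (x : ZMod n → Plane) : Prop where
  disjoint : Pairwise fun i j => Disjoint (T i) (T j)
  touching : ∀ i, ∃ v, closure (T i) ∩ closure (T (i + 1)) = {v}
  clockwise : ∃ θ : Fin n → ℝ, StrictAnti θ ∧ (∀ i j, θ i - θ j < 2 * π) ∧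
    ∀ i : Fin n, ∃ r : ℝ, 0 < r ∧
      x ((i : ℕ) : ZMod n) = (r * cos (θ i), r * sin (θ i))

/-- The description of the dynamics of the map `f` on the energy level `c`: the level is a
necklace of `M` open regular polygons with `s` sides, which are tiles, numbered in clockwise
order by `ℤ/M`; identifying each tile with its center, `f` becomes `i ↦ i + u`; each tile
is invariant by `f^[k]`, which restricted to the tile is a rotation of order `q` about its
center; all points of the tile but the center have (minimal) period `N`. -/
def LevelDescription (f : Plane → Plane) (c M s u k q N : ℕ) : Prop :=
  ∃ (T : ZMod M → Set Plane) (x : ZMod M → Plane),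
    levelSet c = ⋃ i, T i ∧
    (∀ i, (∃ k l m : ℤ, T i = tile k l m) ∧ IsOpenRegularPolygon s (T i) (x i)) ∧
    IsClockwiseNecklace M T x ∧
    (∀ i, f '' T i = T (i + (u : ZMod M)) ∧ f (x i) = x (i + (u : ZMod M))) ∧
    ∀ i, f^[k] '' T i = T i ∧
      IsRotationOfOrderOn f^[k] (T i) (x i) q ∧
      ∀ p ∈ T i, p ≠ x i → minimalPeriod f p = N

/-- The set of (minimal) periods of the periodic points of `f`. -/
def setOfPeriods (f : Plane → Plane) : Set ℕ :=
  {N | ∃ p ∈ periodicPts f, minimalPeriod f p = N}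

/-- A pointwise periodic map: a bijective map such that each point is periodic. -/
def IsPointwisePeriodic (f : Plane → Plane) : Prop :=
  Bijective f ∧ ∀ p, p ∈ periodicPts f

end

noncomputable section

/-! In the coordinates u = `cu`, v = `cv`, w = u + v + 1/2 the grid is the set where u, v or w is an
integer. The map becomes (u, v, w) ↦ (v, 1 - w, 1 - u) for v ≥ 0 and (v, -w, -u) for v < 0. So it
carries each tile to a tile through an integer map on labels, `Label.next`, and acts on the tile as
a rotation of angle 2π/3 between the centers.

The excess m - k - l of a nonempty tile is 0, 1 or 2 (upward triangle, hexagon, downward triangle).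
It is preserved by the map and has the parity of the energy, whence triangles on even levels and
hexagons on odd ones. The labels of energy c are listed explicitly in clockwise order (`triLabel`,
`hexLabel`), and in this list `Label.next` is a translation i ↦ i + u modulo M whose order is 3c +
1. A center thus has period 3c + 1. For another point of the tile, the period must be a multiple of
3c + 1 (to return to the tile) and of 3 (to undo the rotation); these are coprime, so the period is
9c + 3 (`IsLabelCycle.minimalPeriod_eq`).

Points of the grid are covered by the same argument with half-open tiles: they partition the plane,
and since the sign is +1 on y = 0, the map respects the choice of the sides that are included
(`Label.triMap_mem_halfOpenTile`).

For the critical set, the third iterate moves tiles without turning them, so lower edges go to lower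
edges. Each level has a tile with a lower edge on y = 0 which these iterates reach, and the grid
lines of the other two directions become horizontal after one or two steps. -/

/-! ### Affine coordinates adapted to the grid -/

/-- First affine coordinate adapted to the grid. -/
def cu (p : Plane) : ℝ := (3 * p.1 - √3 * p.2) / 6

/-- Second affine coordinate adapted to the grid. -/
def cv (p : Plane) : ℝ := √3 * p.2 / 3

/-- The point with given grid coordinates. -/
def ofUV (u v : ℝ) : Plane := (2 * u + v, √3 * v)

lemma sqrt_three_mul_self : √3 * √3 = (3 : ℝ) := Real.mul_self_sqrt (by norm_num)

lemma sqrt_three_pos : (0 : ℝ) < √3 := Real.sqrt_pos.2 (by norm_num)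

@[simp] lemma cu_ofUV (u v : ℝ) : cu (ofUV u v) = u := by
  simp only [cu, ofUV]; linear_combination (-v / 6) * sqrt_three_mul_self

@[simp] lemma cv_ofUV (u v : ℝ) : cv (ofUV u v) = v := by
  simp only [cv, ofUV]; linear_combination (v / 3) * sqrt_three_mul_self

@[simp] lemma ofUV_cu_cv (p : Plane) : ofUV (cu p) (cv p) = p := by
  ext
  · simp only [cu, cv, ofUV]; ring
  · simp only [cv, ofUV]; linear_combination (p.2 / 3) * sqrt_three_mul_self

lemma plane_ext {p q : Plane} (hu : cu p = cu q) (hv : cv p = cv q) : p = q := by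
  rw [← ofUV_cu_cv p, hu, hv, ofUV_cu_cv]

@[simp] lemma cu_add (p q : Plane) : cu (p + q) = cu p + cu q := by simp [cu]; ring
@[simp] lemma cv_add (p q : Plane) : cv (p + q) = cv p + cv q := by simp [cv]; ring
@[simp] lemma cu_sub (p q : Plane) : cu (p - q) = cu p - cu q := by simp [cu]; ring
@[simp] lemma cv_sub (p q : Plane) : cv (p - q) = cv p - cv q := by simp [cv]; ring
@[simp] lemma cu_neg (p : Plane) : cu (-p) = -cu p := by simp [cu]; ring
@[simp] lemma cv_neg (p : Plane) : cv (-p) = -cv p := by simp [cv]; ring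
@[simp] lemma cu_smul (t : ℝ) (p : Plane) : cu (t • p) = t * cu p := by simp [cu]; ring
@[simp] lemma cv_smul (t : ℝ) (p : Plane) : cv (t • p) = t * cv p := by simp [cv]; ring

lemma continuous_cu : Continuous cu := by unfold cu; fun_prop
lemma continuous_cv : Continuous cv := by unfold cv; fun_prop

lemma cw_eq (p : Plane) : (3 * p.1 + √3 * p.2 + 3) / 6 = cu p + cv p + 1 / 2 := by
  simp only [cu, cv]; ring

lemma cos_two_pi_div_three : cos (2 * π / 3) = -(1 / 2) := by
  rw [show 2 * π / 3 = π - π / 3 by ring, cos_pi_sub, cos_pi_div_three]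

lemma sin_two_pi_div_three : sin (2 * π / 3) = √3 / 2 := by
  rw [show 2 * π / 3 = π - π / 3 by ring, sin_pi_sub, sin_pi_div_three]

@[simp] lemma cu_rot (p : Plane) : cu (rot (2 * π / 3) p) = cv p := by
  simp only [cu, cv, rot, cos_two_pi_div_three, sin_two_pi_div_three]
  linear_combination (p.1 / 12) * sqrt_three_mul_self

@[simp] lemma cv_rot (p : Plane) : cv (rot (2 * π / 3) p) = -(cu p + cv p) := by
  simp only [cu, cv, rot, cos_two_pi_div_three, sin_two_pi_div_three]
  linear_combination (-p.1 / 6) * sqrt_three_mul_self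

/-! ### The map in grid coordinates -/

/-- The map `F` for the angle `2π/3`. -/
abbrev triMap : Plane → Plane := mapF (2 * π / 3)

lemma cu_shear (p : Plane) (s : ℝ) : cu (p.1 - s, p.2) = cu p - s / 2 := by
  simp only [cu]; ring

lemma cv_shear (p : Plane) (s : ℝ) : cv (p.1 - s, p.2) = cv p := rfl

lemma cv_nonneg_iff (p : Plane) : 0 ≤ cv p ↔ 0 ≤ p.2 := by
  rw [show cv p = (√3 / 3) * p.2 by simp only [cv]; ring]
  exact mul_nonneg_iff_of_pos_left (by have := sqrt_three_pos; positivity)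

lemma cv_eq_zero_iff (p : Plane) : cv p = 0 ↔ p.2 = 0 := by
  have := sqrt_three_pos
  simp [cv]

@[simp] lemma cu_triMap (p : Plane) : cu (triMap p) = cv p := by
  simp only [triMap, mapF, cu_rot, cv_shear]

lemma cv_triMap_of_nonneg {p : Plane} (h : 0 ≤ cv p) :
    cv (triMap p) = 1 / 2 - cu p - cv p := by
  simp only [triMap, mapF, cv_rot, cv_shear, cu_shear, sgn, if_pos ((cv_nonneg_iff p).1 h)]
  ring

lemma cv_triMap_of_neg {p : Plane} (h : cv p < 0) :
    cv (triMap p) = -(1 / 2) - cu p - cv p := by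
  have h' : ¬ 0 ≤ p.2 := fun h' => absurd ((cv_nonneg_iff p).2 h') (not_le.2 h)
  simp only [triMap, mapF, cv_rot, cv_shear, cu_shear, sgn, if_neg h']
  ring

/-! Labels of tiles -/

/-- The three integer labels of a tile. -/
@[ext] structure Label where
  /-- First label. -/
  k : ℤ
  /-- Second label. -/
  l : ℤ
  /-- Third label. -/
  m : ℤ

namespace Label

/-- Labels of nonempty tiles. -/
def Valid (L : Label) : Prop := L.k + L.l ≤ L.m ∧ L.m ≤ L.k + L.l + 2

/-- The effect of the map on labels. -/
def next (L : Label) : Label :=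
  if 0 ≤ L.l then ⟨L.l, -L.m, -L.k⟩ else ⟨L.l, -L.m - 1, -L.k - 1⟩

/-- The energy of a label. -/
def energy (L : Label) : ℤ :=
  max |L.k - L.l + L.m| (max (|L.k + L.l + L.m + 1| - 1) |-L.k + L.l + L.m|)

/-- The image of a label by the symmetry about the origin. -/
def reflect (L : Label) : Label := ⟨-1 - L.k, -1 - L.l, -L.m⟩

/-- The open tile of a label. -/
def openTile (L : Label) : Set Plane := tile L.k L.l L.m

/-- The half-open tile of a label; these sets form a partition of the plane. -/
def halfOpenTile (L : Label) : Set Plane :=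
  {p | (L.k ≤ cu p ∧ cu p < L.k + 1) ∧ (L.l ≤ cv p ∧ cv p < L.l + 1) ∧
    (L.m < cu p + cv p + 1 / 2 ∧ cu p + cv p + 1 / 2 ≤ L.m + 1)}

/-- The closed tile of a label. -/
def closedTile (L : Label) : Set Plane :=
  {p | (L.k ≤ cu p ∧ cu p ≤ L.k + 1) ∧ (L.l ≤ cv p ∧ cv p ≤ L.l + 1) ∧
    (L.m ≤ cu p + cv p + 1 / 2 ∧ cu p + cv p + 1 / 2 ≤ L.m + 1)}

/-- The center of the tile of a label. -/
def center (L : Label) : Plane :=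
  ofUV (L.k + (2 * (L.m - L.k - L.l) + 1) / 6) (L.l + (2 * (L.m - L.k - L.l) + 1) / 6)

lemma mem_openTile {L : Label} {p : Plane} : p ∈ L.openTile ↔
    (L.k < cu p ∧ cu p < L.k + 1) ∧ (L.l < cv p ∧ cv p < L.l + 1) ∧
    (L.m < cu p + cv p + 1 / 2 ∧ cu p + cv p + 1 / 2 < L.m + 1) := by
  obtain ⟨u, v, rfl⟩ : ∃ u v, p = ofUV u v := ⟨_, _, (ofUV_cu_cv p).symm⟩
  rw [cu_ofUV, cv_ofUV]
  simp only [openTile, tile, ofUV, mem_ofPred_eq, neg_mul, ← mul_neg,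
    mul_lt_mul_iff_right₀ sqrt_three_pos]
  constructor <;> rintro ⟨⟨h1, h2⟩, ⟨h3, h4⟩, h5, h6⟩ <;>
    refine ⟨⟨?_, ?_⟩, ⟨?_, ?_⟩, ?_, ?_⟩ <;> linarith

lemma openTile_subset_halfOpenTile (L : Label) : L.openTile ⊆ L.halfOpenTile := by
  intro p hp
  obtain ⟨⟨h1, h2⟩, ⟨h3, h4⟩, h5, h6⟩ := mem_openTile.1 hp
  exact ⟨⟨h1.le, h2⟩, ⟨h3.le, h4⟩, h5, h6.le⟩

lemma eq_of_mem_halfOpenTile {L L' : Label} {p : Plane} (h : p ∈ L.halfOpenTile)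
    (h' : p ∈ L'.halfOpenTile) : L = L' := by
  obtain ⟨⟨h1, h2⟩, ⟨h3, h4⟩, h5, h6⟩ := h
  obtain ⟨⟨g1, g2⟩, ⟨g3, g4⟩, g5, g6⟩ := h'
  ext <;> apply le_antisymm <;> apply Int.lt_add_one_iff.1 <;>
    rw [← Int.cast_lt (R := ℝ)] <;> push_cast <;> linarith

lemma exists_mem_halfOpenTile (p : Plane) : ∃ L : Label, L.Valid ∧ p ∈ L.halfOpenTile := by
  have h1 := Int.floor_le (cu p)
  have h2 := Int.lt_floor_add_one (cu p)
  have h3 := Int.floor_le (cv p)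
  have h4 := Int.lt_floor_add_one (cv p)
  have h5 := Int.le_ceil (cu p + cv p + 1 / 2)
  have h6 := Int.ceil_lt_add_one (cu p + cv p + 1 / 2)
  refine ⟨⟨⌊cu p⌋, ⌊cv p⌋, ⌈cu p + cv p + 1 / 2⌉ - 1⟩, ⟨?_, ?_⟩,
    ⟨h1, h2⟩, ⟨h3, h4⟩, ?_, ?_⟩
  · apply Int.lt_add_one_iff.1
    rw [← Int.cast_lt (R := ℝ)]; push_cast; linarith
  · apply Int.lt_add_one_iff.1
    rw [← Int.cast_lt (R := ℝ)]; push_cast; linarith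
  · push_cast; linarith
  · push_cast; linarith

/-- Up to sign, the map permutes the three linear forms inside the absolute values. The additive
constants that it moves change a term only when, by the sign of `L.l`, that term is dominated by
another one. -/
lemma energy_next {L : Label} (h : L.Valid) : L.next.energy = L.energy := by
  obtain ⟨k, l, m⟩ := L
  unfold Valid energy next at *
  simp only at *
  split_ifs <;> simp only [abs] <;> omega

lemma triMap_mem_openTile {L : Label} {p : Plane} (h : p ∈ L.openTile) :
    triMap p ∈ L.next.openTile := by
  obtain ⟨⟨h1, h2⟩, ⟨h3, h4⟩, h5, h6⟩ := mem_openTile.1 h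
  rw [mem_openTile, next]
  split_ifs with hl
  · have : (0 : ℝ) ≤ L.l := by exact_mod_cast hl
    rw [cu_triMap, cv_triMap_of_nonneg (by linarith)]
    push_cast
    refine ⟨⟨?_, ?_⟩, ⟨?_, ?_⟩, ?_, ?_⟩ <;> linarith
  · have : (L.l : ℝ) + 1 ≤ 0 := by exact_mod_cast not_le.1 hl
    rw [cu_triMap, cv_triMap_of_neg (by linarith)]
    push_cast
    refine ⟨⟨?_, ?_⟩, ⟨?_, ?_⟩, ?_, ?_⟩ <;> linarith

/-- The closed sides (lower for u and v, upper for w) are preserved because w enters the new v, and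
u the new w, with a minus sign. The choice v ≥ l agrees with the convention that the sign is +1 at
0. -/
lemma triMap_mem_halfOpenTile {L : Label} {p : Plane} (h : p ∈ L.halfOpenTile) :
    triMap p ∈ L.next.halfOpenTile := by
  obtain ⟨⟨h1, h2⟩, ⟨h3, h4⟩, h5, h6⟩ := h
  rw [halfOpenTile, next, mem_ofPred_eq]
  split_ifs with hl
  · have : (0 : ℝ) ≤ L.l := by exact_mod_cast hl
    rw [cu_triMap, cv_triMap_of_nonneg (by linarith)]
    push_cast
    refine ⟨⟨?_, ?_⟩, ⟨?_, ?_⟩, ?_, ?_⟩ <;> linarith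
  · have : (L.l : ℝ) + 1 ≤ 0 := by exact_mod_cast not_le.1 hl
    rw [cu_triMap, cv_triMap_of_neg (by linarith)]
    push_cast
    refine ⟨⟨?_, ?_⟩, ⟨?_, ?_⟩, ?_, ?_⟩ <;> linarith

/-- The line v = 0 does not split a half-open tile, so both points undergo the same translation
before the rotation. -/
lemma triMap_sub_triMap {L : Label} {p q : Plane} (hp : p ∈ L.halfOpenTile)
    (hq : q ∈ L.halfOpenTile) : triMap p - triMap q = rot (2 * π / 3) (p - q) := by
  obtain ⟨-, ⟨h3, h4⟩, -⟩ := hp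
  obtain ⟨-, ⟨g3, g4⟩, -⟩ := hq
  apply plane_ext
  · simp
  · by_cases hl : 0 ≤ L.l
    · have : (0 : ℝ) ≤ L.l := by exact_mod_cast hl
      rw [cv_sub, cv_triMap_of_nonneg (by linarith), cv_triMap_of_nonneg (by linarith)]
      simp; ring
    · have : (L.l : ℝ) + 1 ≤ 0 := by exact_mod_cast not_le.1 hl
      rw [cv_sub, cv_triMap_of_neg (by linarith), cv_triMap_of_neg (by linarith)]
      simp; ring

lemma center_mem_openTile {L : Label} (h : L.Valid) : L.center ∈ L.openTile := by
  have h1 : (L.k + L.l : ℝ) ≤ L.m := by exact_mod_cast h.1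
  have h2 : (L.m : ℝ) ≤ L.k + L.l + 2 := by exact_mod_cast h.2
  rw [mem_openTile, center, cu_ofUV, cv_ofUV]
  refine ⟨⟨?_, ?_⟩, ⟨?_, ?_⟩, ?_, ?_⟩ <;> linarith

lemma triMap_center {L : Label} (h : L.Valid) : triMap L.center = L.next.center := by
  obtain ⟨-, ⟨h3, h4⟩, -⟩ := mem_openTile.1 (center_mem_openTile h)
  apply plane_ext
  · rw [cu_triMap, center, center, cu_ofUV, cv_ofUV, next]
    split_ifs <;> push_cast <;> ring
  · rw [next]
    split_ifs with hl
    · have : (0 : ℝ) ≤ L.l := by exact_mod_cast hl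
      rw [cv_triMap_of_nonneg (by linarith), center, center, cu_ofUV, cv_ofUV, cv_ofUV]
      push_cast; ring
    · have : (L.l : ℝ) + 1 ≤ 0 := by exact_mod_cast not_le.1 hl
      rw [cv_triMap_of_neg (by linarith), center, center, cu_ofUV, cv_ofUV, cv_ofUV]
      push_cast; ring

lemma center_reflect (L : Label) : L.reflect.center = -L.center := by
  apply plane_ext <;> simp [center, reflect] <;> ring

/-- By convexity, the open segment from a point of the closed tile to the center lies in the open
tile. -/
lemma closure_openTile {L : Label} (h : L.Valid) : closure L.openTile = L.closedTile := by
  apply subset_antisymm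
  · apply closure_minimal
    · intro p hp
      obtain ⟨⟨h1, h2⟩, ⟨h3, h4⟩, h5, h6⟩ := mem_openTile.1 hp
      exact ⟨⟨h1.le, h2.le⟩, ⟨h3.le, h4.le⟩, h5.le, h6.le⟩
    · have hu := continuous_cu
      have hv := continuous_cv
      simp only [closedTile, ofPred_and]
      refine ((isClosed_le ?_ ?_).inter (isClosed_le ?_ ?_)).inter
        (((isClosed_le ?_ ?_).inter (isClosed_le ?_ ?_)).inter
        ((isClosed_le ?_ ?_).inter (isClosed_le ?_ ?_))) <;> fun_prop
  · intro p hp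
    have ht : Filter.Tendsto (fun t : ℝ => p + t • (L.center - p)) (nhdsWithin 0 (Ioo 0 1))
        (nhds p) := by
      have : Continuous (fun t : ℝ => p + t • (L.center - p)) := by fun_prop
      simpa using (this.tendsto 0).mono_left nhdsWithin_le_nhds
    have : (nhdsWithin (0 : ℝ) (Ioo 0 1)).NeBot := by
      rw [nhdsWithin_Ioo_eq_nhdsGT one_pos]; infer_instance
    refine mem_closure_of_tendsto ht ?_
    filter_upwards [self_mem_nhdsWithin] with t ht
    obtain ⟨t0, t1⟩ := ht
    obtain ⟨⟨h1, h2⟩, ⟨h3, h4⟩, h5, h6⟩ := mem_openTile.1 (center_mem_openTile h)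
    obtain ⟨⟨g1, g2⟩, ⟨g3, g4⟩, g5, g6⟩ := hp
    rw [mem_openTile]
    simp only [cu_add, cv_add, cu_smul, cv_smul, cu_sub, cv_sub]
    refine ⟨⟨?_, ?_⟩, ⟨?_, ?_⟩, ?_, ?_⟩ <;> nlinarith

lemma mem_zeroFree_iff {p : Plane} : p ∈ zeroFree ↔
    (∀ k : ℤ, cu p ≠ k) ∧ (∀ l : ℤ, cv p ≠ l) ∧ ∀ m : ℤ, cu p + cv p + 1 / 2 ≠ m := by
  obtain ⟨u, v, rfl⟩ : ∃ u v, p = ofUV u v := ⟨_, _, (ofUV_cu_cv p).symm⟩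
  rw [cu_ofUV, cv_ofUV]
  have h0 := sqrt_three_pos.ne'
  simp only [zeroFree, grid, mem_compl_iff, mem_ofPred_eq, not_or, not_exists, ofUV, neg_mul,
    ← mul_neg, mul_right_inj' h0]
  refine and_congr ?_ (and_congr Iff.rfl ?_)
  · refine forall_congr' fun k => not_congr ⟨fun h => ?_, fun h => ?_⟩ <;> linarith
  · constructor
    · intro h m hm
      exact h (m - 1) (by push_cast; linarith)
    · intro h m hm
      exact h (m + 1) (by push_cast; linarith)

lemma openTile_subset_zeroFree (L : Label) : L.openTile ⊆ zeroFree := by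
  intro p hp
  obtain ⟨⟨h1, h2⟩, ⟨h3, h4⟩, h5, h6⟩ := mem_openTile.1 hp
  rw [mem_zeroFree_iff]
  refine ⟨fun k hk => ?_, fun k hk => ?_, fun k hk => ?_⟩
  · rw [hk] at h1 h2; norm_cast at h1 h2; omega
  · rw [hk] at h3 h4; norm_cast at h3 h4; omega
  · rw [hk] at h5 h6; norm_cast at h5 h6; omega

lemma exists_mem_openTile {p : Plane} (hp : p ∈ zeroFree) :
    ∃ L : Label, L.Valid ∧ p ∈ L.openTile := by
  obtain ⟨L, hL, ⟨h1, h2⟩, ⟨h3, h4⟩, h5, h6⟩ := exists_mem_halfOpenTile p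
  obtain ⟨g1, g2, g3⟩ := mem_zeroFree_iff.1 hp
  refine ⟨L, hL, mem_openTile.2 ⟨⟨h1.lt_of_ne (g1 _).symm, h2⟩, ⟨h3.lt_of_ne (g2 _).symm, h4⟩,
    h5, h6.lt_of_ne ?_⟩⟩
  exact_mod_cast g3 (L.m + 1)

lemma valid_of_mem_halfOpenTile {L : Label} {p : Plane} (hp : p ∈ L.halfOpenTile) :
    L.Valid := by
  obtain ⟨L', hL', h'⟩ := exists_mem_halfOpenTile p
  rwa [eq_of_mem_halfOpenTile hp h']

lemma funV_eq_energy {L : Label} {p : Plane} (hp : p ∈ L.openTile) : funV p = L.energy := by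
  obtain ⟨⟨h1, h2⟩, ⟨h3, h4⟩, h5, h6⟩ := mem_openTile.1 hp
  have hB : labelB p = L.k := Int.floor_eq_iff.2 ⟨h1.le, h2⟩
  have hC : labelC p = L.l := Int.floor_eq_iff.2 ⟨h3.le, h4⟩
  have hD : labelD p = L.m := by
    rw [labelD, cw_eq]; exact Int.floor_eq_iff.2 ⟨h5.le, h6⟩
  simp only [funV, hB, hC, hD, energy]

lemma levelSet_eq (c : ℕ) :
    levelSet c = {p | ∃ L : Label, L.Valid ∧ L.energy = c ∧ p ∈ L.openTile} := by
  ext p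
  constructor
  · rintro ⟨hp, hV⟩
    obtain ⟨L, hL, hpL⟩ := exists_mem_openTile hp
    refine ⟨L, hL, ?_, hpL⟩
    rw [funV_eq_energy hpL] at hV
    exact_mod_cast hV
  · rintro ⟨L, hL, hE, hpL⟩
    exact ⟨openTile_subset_zeroFree L hpL, by rw [funV_eq_energy hpL, hE]; simp⟩

/-! ### Tiles with a common vertex -/

/-- One orientation of the relation of having tiles with exactly one common vertex. -/
def Touches (L L' : Label) : Prop :=
  (L.m = L.k + L.l ∧ (L' = ⟨L.k - 1, L.l - 1, L.m⟩ ∨ L' = ⟨L.k, L.l - 1, L.m + 1⟩ ∨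
    L' = ⟨L.k - 1, L.l, L.m + 1⟩)) ∨
  (L.m = L.k + L.l + 1 ∧ (L' = ⟨L.k + 1, L.l - 1, L.m⟩ ∨ L' = ⟨L.k + 1, L.l, L.m + 1⟩ ∨
    L' = ⟨L.k, L.l + 1, L.m + 1⟩))

lemma Touches.valid {L L' : Label} (h : L.Touches L') : L.Valid ∧ L'.Valid := by
  obtain ⟨k, l, m⟩ := L
  unfold Valid
  rcases h with ⟨hm, rfl | rfl | rfl⟩ | ⟨hm, rfl | rfl | rfl⟩ <;> simp only at * <;> omega

lemma eq_singleton_ofUV {S : Set Plane} {a b : ℝ} (h : ofUV a b ∈ S)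
    (h' : ∀ p ∈ S, cu p = a ∧ cv p = b) : S = {ofUV a b} :=
  eq_singleton_iff_unique_mem.2 ⟨h, fun p hp => plane_ext (by simp [(h' p hp).1])
    (by simp [(h' p hp).2])⟩

lemma Touches.exists_closedTile {L L' : Label} (h : L.Touches L') :
    ∃ v, L.closedTile ∩ L'.closedTile = {v} := by
  have key : ∀ a b : ℝ, ofUV a b ∈ L.closedTile → ofUV a b ∈ L'.closedTile →
      (∀ p ∈ L.closedTile, p ∈ L'.closedTile → cu p = a ∧ cv p = b) →
      ∃ v, L.closedTile ∩ L'.closedTile = {v} := fun a b h1 h2 h3 =>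
    ⟨_, eq_singleton_ofUV ⟨h1, h2⟩ fun p hp => h3 p hp.1 hp.2⟩
  obtain ⟨k, l, m⟩ := L
  rcases h with ⟨hm, rfl | rfl | rfl⟩ | ⟨hm, rfl | rfl | rfl⟩ <;> simp only at hm <;> subst hm
  -- In each of the six configurations the point supplied is the shared vertex; the opposite bounds
  -- of the two closed tiles force it.
  on_goal 6 => apply key (k + 1 / 2) (l + 1)
  on_goal 5 => apply key (k + 1) (l + 1 / 2)
  on_goal 4 => apply key (k + 1) l
  on_goal 3 => apply key k (l + 1 / 2)
  on_goal 2 => apply key (k + 1 / 2) l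
  on_goal 1 => apply key k l
  all_goals first
  | rintro p ⟨⟨h1, h2⟩, ⟨h3, h4⟩, h5, h6⟩ ⟨⟨g1, g2⟩, ⟨g3, g4⟩, g5, g6⟩
    push_cast at *
    constructor <;> linarith
  | simp only [closedTile, mem_ofPred_eq, cu_ofUV, cv_ofUV]; push_cast
    refine ⟨⟨?_, ?_⟩, ⟨?_, ?_⟩, ?_, ?_⟩ <;> linarith

lemma exists_closure_inter {L L' : Label} (h : L.Touches L' ∨ L'.Touches L) :
    ∃ v, closure L.openTile ∩ closure L'.openTile = {v} := by
  rcases h with h | h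
  · rw [closure_openTile h.valid.1, closure_openTile h.valid.2]
    exact h.exists_closedTile
  · rw [closure_openTile h.valid.1, closure_openTile h.valid.2, inter_comm]
    exact h.exists_closedTile

end Label

/-! ### Tiles as regular polygons -/

/-- Turns the half-plane conditions of a regular polygon into linear inequalities in the grid
coordinates. -/
lemma cos_mul_add_sin_mul (x y : ℝ) (d : Plane) :
    x * d.1 + y * d.2 = 2 * x * cu d + (x + √3 * y) * cv d := by
  simp only [cu, cv]; linear_combination (-y * d.2 / 3) * sqrt_three_mul_self

lemma cos_five_pi_div_six : cos (5 * π / 6) = -(√3 / 2) := by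
  rw [show 5 * π / 6 = π - π / 6 by ring, cos_pi_sub, cos_pi_div_six]

lemma sin_five_pi_div_six : sin (5 * π / 6) = 1 / 2 := by
  rw [show 5 * π / 6 = π - π / 6 by ring, sin_pi_sub, sin_pi_div_six]

lemma cos_seven_pi_div_six : cos (7 * π / 6) = -(√3 / 2) := by
  rw [show 7 * π / 6 = π / 6 + π by ring, cos_add_pi, cos_pi_div_six]

lemma sin_seven_pi_div_six : sin (7 * π / 6) = -(1 / 2) := by
  rw [show 7 * π / 6 = π / 6 + π by ring, sin_add_pi, sin_pi_div_six]

lemma cos_eleven_pi_div_six : cos (11 * π / 6) = √3 / 2 := by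
  rw [show 11 * π / 6 = -(π / 6) + 2 * π by ring, cos_add_two_pi, cos_neg, cos_pi_div_six]

lemma sin_eleven_pi_div_six : sin (11 * π / 6) = -(1 / 2) := by
  rw [show 11 * π / 6 = -(π / 6) + 2 * π by ring, sin_add_two_pi, sin_neg, sin_pi_div_six]

namespace Label

/-- With excess 0 the upper bounds on u and v and the lower bound on w follow from the other three
inequalities, which bound a triangle. -/
lemma isOpenRegularPolygon_of_upward {L : Label} (h : L.m = L.k + L.l) :
    IsOpenRegularPolygon 3 L.openTile L.center := by
  have h' : (L.m : ℝ) = L.k + L.l := by exact_mod_cast h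
  have h3 := sqrt_three_pos
  -- The inradius of a triangle of side 1; the first normal is that of the lower edge.
  refine ⟨√3 / 6, -(π / 2), by positivity, ?_⟩
  ext p
  simp only [mem_openTile, mem_ofPred_eq, Fin.forall_fin_succ, ← Prod.fst_sub, ← Prod.snd_sub,
    cos_mul_add_sin_mul, cu_sub, cv_sub, IsEmpty.forall_iff, and_true, Fin.val_zero, Fin.val_succ]
  push_cast
  rw [show -(π / 2) + 2 * π * 0 / 3 = -(π / 2) by ring,
    show -(π / 2) + 2 * π * 1 / 3 = π / 6 by ring,
    show -(π / 2) + 2 * π * 2 / 3 = 5 * π / 6 by ring, cos_neg, sin_neg,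
    cos_pi_div_two, sin_pi_div_two, cos_pi_div_six, sin_pi_div_six, cos_five_pi_div_six,
    sin_five_pi_div_six, center, cu_ofUV, cv_ofUV, h']
  constructor
  · rintro ⟨⟨h1, h2⟩, ⟨h4, h5⟩, h6, h7⟩
    rw [← mul_lt_mul_iff_right₀ h3] at h1 h2 h4 h5 h6 h7
    refine ⟨?_, ?_, ?_⟩ <;> linarith
  · rintro ⟨h1, h2, h4⟩
    refine ⟨⟨?_, ?_⟩, ⟨?_, ?_⟩, ?_, ?_⟩ <;> refine lt_of_mul_lt_mul_left ?_ h3.le <;> linarith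

lemma isOpenRegularPolygon_of_downward {L : Label} (h : L.m = L.k + L.l + 2) :
    IsOpenRegularPolygon 3 L.openTile L.center := by
  have h' : (L.m : ℝ) = L.k + L.l + 2 := by exact_mod_cast h
  have h3 := sqrt_three_pos
  refine ⟨√3 / 6, π / 2, by positivity, ?_⟩
  ext p
  simp only [mem_openTile, mem_ofPred_eq, Fin.forall_fin_succ, ← Prod.fst_sub, ← Prod.snd_sub,
    cos_mul_add_sin_mul, cu_sub, cv_sub, IsEmpty.forall_iff, and_true, Fin.val_zero, Fin.val_succ]
  push_cast
  rw [show π / 2 + 2 * π * 0 / 3 = π / 2 by ring,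
    show π / 2 + 2 * π * 1 / 3 = 7 * π / 6 by ring,
    show π / 2 + 2 * π * 2 / 3 = 11 * π / 6 by ring,
    cos_pi_div_two, sin_pi_div_two, cos_seven_pi_div_six, sin_seven_pi_div_six,
    cos_eleven_pi_div_six, sin_eleven_pi_div_six, center, cu_ofUV, cv_ofUV, h']
  constructor
  · rintro ⟨⟨h1, h2⟩, ⟨h4, h5⟩, h6, h7⟩
    rw [← mul_lt_mul_iff_right₀ h3] at h1 h2 h4 h5 h6 h7
    refine ⟨?_, ?_, ?_⟩ <;> linarith
  · rintro ⟨h1, h2, h4⟩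
    refine ⟨⟨?_, ?_⟩, ⟨?_, ?_⟩, ?_, ?_⟩ <;> refine lt_of_mul_lt_mul_left ?_ h3.le <;> linarith

lemma isOpenRegularPolygon_of_hexagonal {L : Label} (h : L.m = L.k + L.l + 1) :
    IsOpenRegularPolygon 6 L.openTile L.center := by
  have h' : (L.m : ℝ) = L.k + L.l + 1 := by exact_mod_cast h
  have h3 := sqrt_three_pos
  -- The inradius of a hexagon of side 1. Here all six inequalities are sides.
  refine ⟨√3 / 2, -(π / 2), by positivity, ?_⟩
  ext p
  simp only [mem_openTile, mem_ofPred_eq, Fin.forall_fin_succ, ← Prod.fst_sub, ← Prod.snd_sub,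
    cos_mul_add_sin_mul, cu_sub, cv_sub, IsEmpty.forall_iff, and_true, Fin.val_zero, Fin.val_succ]
  push_cast
  rw [show -(π / 2) + 2 * π * 0 / 6 = -(π / 2) by ring,
    show -(π / 2) + 2 * π * 1 / 6 = -(π / 6) by ring,
    show -(π / 2) + 2 * π * 2 / 6 = π / 6 by ring,
    show -(π / 2) + 2 * π * 3 / 6 = π / 2 by ring,
    show -(π / 2) + 2 * π * 4 / 6 = 5 * π / 6 by ring,
    show -(π / 2) + 2 * π * 5 / 6 = 7 * π / 6 by ring,
    cos_neg, sin_neg, cos_neg, sin_neg,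
    cos_pi_div_two, sin_pi_div_two, cos_pi_div_six, sin_pi_div_six, cos_five_pi_div_six,
    sin_five_pi_div_six, cos_seven_pi_div_six, sin_seven_pi_div_six, center, cu_ofUV, cv_ofUV, h']
  constructor
  · rintro ⟨⟨h1, h2⟩, ⟨h4, h5⟩, h6, h7⟩
    rw [← mul_lt_mul_iff_right₀ h3] at h1 h2 h4 h5 h6 h7
    refine ⟨?_, ?_, ?_, ?_, ?_, ?_⟩ <;> linarith
  · rintro ⟨h1, h2, h4, h5, h6, h7⟩
    refine ⟨⟨?_, ?_⟩, ⟨?_, ?_⟩, ?_, ?_⟩ <;> refine lt_of_mul_lt_mul_left ?_ h3.le <;> linarith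

end Label

/-! ### Polar angles and clockwise order -/

/-- The polar form of a point on the positive side of the line `u = 0`. -/
lemma exists_polar {p : Plane} (hp : 0 < cu p) : ∃ r : ℝ, 0 < r ∧
    p = (r * cos (arctan ((1 + 2 * (cv p / cu p)) / √3) - π / 6),
      r * sin (arctan ((1 + 2 * (cv p / cu p)) / √3) - π / 6)) := by
  obtain ⟨u, v, rfl⟩ : ∃ u v, p = ofUV u v := ⟨_, _, (ofUV_cu_cv p).symm⟩
  rw [cu_ofUV] at hp
  rw [cu_ofUV, cv_ofUV]
  set t := (1 + 2 * (v / u)) / √3 with ht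
  have h3 := sqrt_three_pos
  have hs : 0 < √(1 + t ^ 2) := Real.sqrt_pos.2 (by positivity)
  refine ⟨√3 * u * √(1 + t ^ 2), by positivity, ?_⟩
  -- After a rotation by π/6 the half-plane u > 0 becomes the right half-plane and the point has
  -- coordinates (√3 u, u + 2v), so t is the tangent of the rotated angle.
  have htu : √3 * u * t = u + 2 * v := by rw [ht]; field_simp
  rw [cos_sub, sin_sub, cos_arctan, sin_arctan, cos_pi_div_six, sin_pi_div_six]
  have e1 : √3 * u * √(1 + t ^ 2) * (1 / √(1 + t ^ 2)) = √3 * u := by field_simp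
  have e2 : √3 * u * √(1 + t ^ 2) * (t / √(1 + t ^ 2)) = u + 2 * v := by
    rw [← htu]; field_simp
  ext
  · simp only [ofUV]
    linear_combination (-√3 / 2) * e1 - (1 / 2) * e2 - (u / 2) * sqrt_three_mul_self
  · simp only [ofUV]
    linear_combination (-√3 / 2) * e2 + (1 / 2) * e1

/-- A criterion for a centrally symmetric sequence of points to turn clockwise. -/
lemma exists_clockwise_angles {h : ℕ} {x : ℕ → Plane} (hpos : ∀ i < h, 0 < cu (x i))
    (hneg : ∀ i < h, x (i + h) = -x i)
    (hcr : ∀ i, i + 1 < h → cu (x i) * cv (x (i + 1)) < cv (x i) * cu (x (i + 1))) :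
    ∃ θ : Fin (2 * h) → ℝ, StrictAnti θ ∧ (∀ i j, θ i - θ j < 2 * π) ∧
      ∀ i : Fin (2 * h), ∃ r : ℝ, 0 < r ∧ x i = (r * cos (θ i), r * sin (θ i)) := by
  have h3 := sqrt_three_pos
  set A : ℕ → ℝ := fun i => arctan ((1 + 2 * (cv (x i) / cu (x i))) / √3) with hA
  have hstep : ∀ i, i + 1 < h → A (i + 1) < A i := by
    intro i hi
    apply arctan_strictMono
    have h1 := hpos i (by omega)
    have h2 := hpos (i + 1) hi
    have : cv (x (i + 1)) / cu (x (i + 1)) < cv (x i) / cu (x i) := by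
      rw [div_lt_div_iff₀ h2 h1]; linarith [hcr i hi]
    gcongr
  have hanti : ∀ d i, i + d + 1 < h → A (i + d + 1) < A i := by
    intro d
    induction d with
    | zero => intro i hi; exact hstep i hi
    | succ d ih => intro i hi; exact (hstep (i + d + 1) hi).trans (ih i (by omega))
  have hsymm : ∀ i < h, A (i + h) = A i := by
    intro i hi
    simp only [hA, hneg i hi, cu_neg, cv_neg, neg_div_neg_eq]
  have hlt : ∀ i j, i < j → j < h → A j < A i := by
    intro i j hij hj
    obtain ⟨d, rfl⟩ := Nat.exists_eq_add_of_lt hij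
    exact hanti d i hj
  have hb1 : ∀ i, A i < π / 2 := fun i => arctan_lt_pi_div_two _
  have hb2 : ∀ i, -(π / 2) < A i := fun i => neg_pi_div_two_lt_arctan _
  have hπ := pi_pos
  -- The first half of the points lies in an open half-plane, where the arctangent is a continuous
  -- choice of angle; their antipodes get the same angles minus π, hence one turn in all.
  refine ⟨fun i => A i - π / 6 - (if (i : ℕ) < h then 0 else π), ?_, ?_, ?_⟩
  · intro i j hij
    have hij' : (i : ℕ) < j := hij
    simp only
    have hj := j.2
    split_ifs with h1 h2
    · linarith [hlt i j hij' h1]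
    · omega
    · linarith [hb1 j, hb2 i]
    · obtain ⟨a, ha⟩ := Nat.exists_eq_add_of_le' (not_lt.1 h1)
      obtain ⟨b, hb⟩ := Nat.exists_eq_add_of_le' (not_lt.1 ‹¬ (i : ℕ) < h›)
      rw [ha, hb, hsymm a (by omega), hsymm b (by omega)]
      linarith [hlt b a (by omega) (by omega)]
  · intro i j
    simp only
    split_ifs <;> linarith [hb1 i, hb2 j]
  · intro i
    simp only
    have hi := i.2
    split_ifs with h1
    · simpa using exists_polar (hpos i h1)
    · obtain ⟨a, ha⟩ := Nat.exists_eq_add_of_le' (not_lt.1 h1)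
      obtain ⟨r, hr, hx⟩ := exists_polar (hpos a (by omega))
      refine ⟨r, hr, ?_⟩
      rw [ha, hneg a (by omega), hsymm a (by omega), cos_sub_pi, sin_sub_pi]
      nth_rewrite 1 [hx]
      ext <;> simp [hA]

/-! ### Dynamics on a cycle of tiles -/

lemma rot_iterate_three : (rot (2 * π / 3))^[3] = id := by
  funext p
  apply plane_ext <;> simp

/-- Otherwise j is coprime to 3, so d is fixed by the rotation itself, whose only fixed point is the
origin. -/
lemma three_dvd_of_rot_iterate_eq {d : Plane} (hd : d ≠ 0) {j : ℕ}
    (h : (rot (2 * π / 3))^[j] d = d) : 3 ∣ j := by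
  have h3 : IsPeriodicPt (rot (2 * π / 3)) 3 d := by
    rw [IsPeriodicPt, rot_iterate_three]; rfl
  have hj : IsPeriodicPt (rot (2 * π / 3)) j d := h
  by_contra hnd
  have h1 : IsPeriodicPt (rot (2 * π / 3)) 1 d := by
    have := hj.gcd h3
    rwa [((Nat.Prime.coprime_iff_not_dvd Nat.prime_three).2 hnd).symm.gcd_eq_one] at this
  apply hd
  have e : rot (2 * π / 3) d = d := h1
  have e1 := congrArg cu e
  have e2 := congrArg cv e
  rw [cu_rot] at e1
  rw [cv_rot] at e2
  have e0 : cu (0 : Plane) = 0 ∧ cv (0 : Plane) = 0 := by simp [cu, cv]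
  apply plane_ext
  · rw [e0.1]; linarith
  · rw [e0.2]; linarith

lemma rot_iterate_three_mul_add_one (c : ℕ) :
    (rot (2 * π / 3))^[3 * c + 1] = rot (2 * π / 3) := by
  rw [iterate_succ', iterate_mul, rot_iterate_three, iterate_id, comp_id]

lemma addOrderOf_two_pi_div_three : addOrderOf ((2 * π / 3 : ℝ) : Real.Angle) = 3 := by
  have : Fact (Nat.Prime 3) := ⟨Nat.prime_three⟩
  apply addOrderOf_eq_prime
  · rw [← Real.Angle.coe_nsmul, show (3 : ℕ) • (2 * π / 3) = 2 * π by
      simp only [nsmul_eq_mul]; push_cast; ring, Real.Angle.coe_two_pi]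
  · intro h
    have := congrArg Real.Angle.sin h
    rw [Real.Angle.sin_coe, Real.Angle.sin_zero, sin_two_pi_div_three] at this
    linarith [sqrt_three_pos]

/-- A cyclic family of labels on which the map acts by a translation. -/
structure IsLabelCycle {M : ℕ} (G : ZMod M → Label) (u : ZMod M) : Prop where
  valid : ∀ i, (G i).Valid
  inj : Injective G
  next : ∀ i, (G i).next = G (i + u)

namespace IsLabelCycle

variable {M : ℕ} {G : ZMod M → Label} {u : ZMod M}

lemma iterate_mem_openTile (h : IsLabelCycle G u) {i : ZMod M} {p : Plane}
    (hp : p ∈ (G i).openTile) (j : ℕ) : triMap^[j] p ∈ (G (i + j * u)).openTile := by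
  induction j with
  | zero => simpa using hp
  | succ j ih =>
    rw [iterate_succ_apply']
    have := Label.triMap_mem_openTile ih
    rwa [h.next, show i + j * u + u = i + (j + 1 : ℕ) * u by push_cast; ring] at this

lemma iterate_mem_halfOpenTile (h : IsLabelCycle G u) {i : ZMod M} {p : Plane}
    (hp : p ∈ (G i).halfOpenTile) (j : ℕ) : triMap^[j] p ∈ (G (i + j * u)).halfOpenTile := by
  induction j with
  | zero => simpa using hp
  | succ j ih =>
    rw [iterate_succ_apply']
    have := Label.triMap_mem_halfOpenTile ih
    rwa [h.next, show i + j * u + u = i + (j + 1 : ℕ) * u by push_cast; ring] at this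

lemma center_mem_halfOpenTile (h : IsLabelCycle G u) (i : ZMod M) :
    (G i).center ∈ (G i).halfOpenTile :=
  Label.openTile_subset_halfOpenTile _ (Label.center_mem_openTile (h.valid i))

lemma iterate_eq (h : IsLabelCycle G u) {i : ZMod M} {p : Plane}
    (hp : p ∈ (G i).halfOpenTile) (j : ℕ) :
    triMap^[j] p = (G (i + j * u)).center + (rot (2 * π / 3))^[j] (p - (G i).center) := by
  induction j with
  | zero => simp
  | succ j ih =>
    have := Label.triMap_sub_triMap (h.iterate_mem_halfOpenTile hp j)
      (h.center_mem_halfOpenTile _)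
    rw [Label.triMap_center (h.valid _), h.next, ← iterate_succ_apply' triMap, sub_eq_iff_eq_add,
      ih, add_sub_cancel_left, ← iterate_succ_apply' (rot (2 * π / 3)), add_comm] at this
    rw [this, show i + j * u + u = i + (j + 1 : ℕ) * u by push_cast; ring]

/-- Return to a point splits into return of the label, because half-open tiles partition the plane
and the labelling is injective, and return of the displacement from the center. -/
lemma iterate_eq_iff (h : IsLabelCycle G u) {i : ZMod M} {p : Plane}
    (hp : p ∈ (G i).halfOpenTile) (j : ℕ) : triMap^[j] p = p ↔
      (j : ZMod M) * u = 0 ∧ (rot (2 * π / 3))^[j] (p - (G i).center) = p - (G i).center := by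
  constructor
  · intro hj
    have h1 := h.iterate_mem_halfOpenTile hp j
    rw [hj] at h1
    have h2 : (j : ZMod M) * u = 0 := by
      simpa using (h.inj (Label.eq_of_mem_halfOpenTile hp h1)).symm
    refine ⟨h2, ?_⟩
    have h3 := h.iterate_eq hp j
    rw [hj, h2, add_zero] at h3
    rw [eq_comm, sub_eq_iff_eq_add, add_comm]
    exact h3
  · rintro ⟨h1, h2⟩
    rw [h.iterate_eq hp, h1, h2]
    simp

lemma rot_iterate_zero (j : ℕ) : (rot (2 * π / 3))^[j] 0 = 0 :=
  iterate_fixed (by simp [rot]) j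

lemma minimalPeriod_center (h : IsLabelCycle G u) {k : ℕ}
    (hk : ∀ j : ℕ, (j : ZMod M) * u = 0 ↔ k ∣ j) (i : ZMod M) :
    minimalPeriod triMap (G i).center = k := by
  have key : ∀ j, triMap^[j] (G i).center = (G i).center ↔ k ∣ j := fun j => by
    rw [h.iterate_eq_iff (h.center_mem_halfOpenTile i), sub_self, rot_iterate_zero, hk]
    simp
  apply Nat.dvd_antisymm
  · exact IsPeriodicPt.minimalPeriod_dvd ((key k).2 dvd_rfl)
  · exact (key _).1 (isPeriodicPt_minimalPeriod _ _)

lemma minimalPeriod_eq (h : IsLabelCycle G u) {c : ℕ}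
    (hk : ∀ j : ℕ, (j : ZMod M) * u = 0 ↔ 3 * c + 1 ∣ j) {i : ZMod M} {p : Plane}
    (hp : p ∈ (G i).halfOpenTile) (hc : p ≠ (G i).center) :
    minimalPeriod triMap p = 9 * c + 3 := by
  have e : 9 * c + 3 = 3 * (3 * c + 1) := by ring
  apply Nat.dvd_antisymm
  · apply IsPeriodicPt.minimalPeriod_dvd
    refine (h.iterate_eq_iff hp _).2 ⟨(hk _).2 (e ▸ dvd_mul_left _ _), ?_⟩
    rw [e, iterate_mul, rot_iterate_three, iterate_id, id]
  · obtain ⟨h1, h2⟩ := (h.iterate_eq_iff hp _).1 (isPeriodicPt_minimalPeriod triMap p)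
    rw [e]
    refine Nat.Coprime.mul_dvd_of_dvd_of_dvd ?_ (three_dvd_of_rot_iterate_eq (sub_ne_zero.2 hc) h2)
      ((hk _).1 h1)
    rw [Nat.coprime_mul_left_add_right]
    exact Nat.coprime_one_right 3

lemma mem_periodicPts (h : IsLabelCycle G u) {c : ℕ}
    (hk : ∀ j : ℕ, (j : ZMod M) * u = 0 ↔ 3 * c + 1 ∣ j) {i : ZMod M} {p : Plane}
    (hp : p ∈ (G i).halfOpenTile) : p ∈ periodicPts triMap := by
  rw [← minimalPeriod_pos_iff_mem_periodicPts]
  by_cases hc : p = (G i).center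
  · rw [hc, h.minimalPeriod_center hk]; omega
  · rw [h.minimalPeriod_eq hk hp hc]; omega

lemma image_openTile (h : IsLabelCycle G u) {c : ℕ}
    (hk : ∀ j : ℕ, (j : ZMod M) * u = 0 ↔ 3 * c + 1 ∣ j) (i : ZMod M) (j : ℕ) :
    triMap^[j] '' (G i).openTile = (G (i + j * u)).openTile := by
  apply subset_antisymm
  · rintro _ ⟨p, hp, rfl⟩
    exact h.iterate_mem_openTile hp j
  · intro q hq
    have hN : triMap^[j * (9 * c + 3)] q = q := by
      refine (h.iterate_eq_iff (Label.openTile_subset_halfOpenTile _ hq) _).2 ⟨(hk _).2 ?_, ?_⟩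
      · exact Dvd.intro_left (j * 3) (by ring)
      · rw [show j * (9 * c + 3) = 3 * (j * (3 * c + 1)) by ring, iterate_mul,
          rot_iterate_three, iterate_id, id]
    -- Every point of these tiles has 9c + 3 as a period, so 9c + 2 further steps invert the map.
    refine ⟨triMap^[j * (9 * c + 2)] q, ?_, ?_⟩
    · have := h.iterate_mem_openTile hq (j * (9 * c + 2))
      have h0 : ((j * (9 * c + 3) : ℕ) : ZMod M) * u = 0 :=
        (hk _).2 (Dvd.intro_left (j * 3) (by ring))
      rwa [show i + j * u + ((j * (9 * c + 2) : ℕ) : ZMod M) * u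
        = i + ((j * (9 * c + 3) : ℕ) : ZMod M) * u by push_cast; ring, h0, add_zero] at this
    · rw [← iterate_add_apply, show j + j * (9 * c + 2) = j * (9 * c + 3) by ring, hN]

lemma excess_eq (h : IsLabelCycle G u) (i : ZMod M) (j : ℕ) :
    (G (i + j * u)).m - (G (i + j * u)).k - (G (i + j * u)).l =
      (G i).m - (G i).k - (G i).l := by
  induction j with
  | zero => simp
  | succ j ih =>
    rw [← ih, show i + (j + 1 : ℕ) * u = i + j * u + u by push_cast; ring, ← h.next]
    unfold Label.next
    split_ifs <;> simp only <;> ring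

/-- The height of the center above the level v = l depends only on the excess, which is invariant,
and the cube of the rotation is the identity; lower edges therefore go to lower edges. -/
lemma cv_iterate_three_mul (h : IsLabelCycle G u) {i : ZMod M} {p : Plane}
    (hp : p ∈ (G i).halfOpenTile) (hv : cv p = (G i).l) (j : ℕ) :
    cv (triMap^[3 * j] p) = (G (i + (3 * j : ℕ) * u)).l := by
  have he := h.excess_eq i (3 * j)
  rw [h.iterate_eq hp, iterate_mul, rot_iterate_three, iterate_id, id, cv_add, cv_sub, hv,
    Label.center, Label.center, cv_ofUV, cv_ofUV]
  have he' := congrArg (Int.cast (R := ℝ)) he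
  simp only [Int.cast_sub] at he'
  linarith

end IsLabelCycle

/-! ### From a labelling of a level to its description -/

/-- A numbering in clockwise order of the labels of energy `c`, whose tiles have `s` sides, by
`0, …, M - 1`, such that the map acts as the translation by `u` modulo `M`. -/
structure IsNecklaceLabelling (c M s u : ℕ) (lab : ℕ → Label) : Prop where
  valid : ∀ i < M, (lab i).Valid
  energy : ∀ i < M, (lab i).energy = c
  surj : ∀ L : Label, L.Valid → L.energy = c → ∃ i < M, lab i = L
  inj : ∀ i < M, ∀ j < M, lab i = lab j → i = j
  next : ∀ i < M, (lab i).next = lab ((i + u) % M)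
  touches : ∀ i < M, (lab i).Touches (lab ((i + 1) % M)) ∨ (lab ((i + 1) % M)).Touches (lab i)
  sides : ∀ i < M, s = 3 ∧ ((lab i).m = (lab i).k + (lab i).l ∨
    (lab i).m = (lab i).k + (lab i).l + 2) ∨ s = 6 ∧ (lab i).m = (lab i).k + (lab i).l + 1
  -- The hypotheses of `exists_clockwise_angles`: central symmetry, the first half in u > 0, and
  -- negative cross products of consecutive centers.
  half : ∃ h, M = 2 * h ∧ (∀ i < h, lab (i + h) = (lab i).reflect) ∧
    (∀ i < h, 0 < cu (lab i).center) ∧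
    ∀ i, i + 1 < h → cu (lab i).center * cv (lab (i + 1)).center <
      cv (lab i).center * cu (lab (i + 1)).center
  period : ∀ j, M ∣ j * u ↔ 3 * c + 1 ∣ j
  -- Excess at most 1 means that the half-open tile contains points with v = l; a downward triangle
  -- meets that line only in an excluded vertex.
  edge : ∀ i < M, (lab i).m ≤ (lab i).k + (lab i).l + 1 →
    ∃ j, (lab ((i + 3 * j * u) % M)).l = 0

namespace IsNecklaceLabelling

variable {c M s u : ℕ} {lab : ℕ → Label}

lemma isLabelCycle [NeZero M] (h : IsNecklaceLabelling c M s u lab) :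
    IsLabelCycle (fun i : ZMod M => lab i.val) (u : ZMod M) where
  valid i := h.valid _ i.val_lt
  inj i j hij := ZMod.val_injective M (h.inj _ i.val_lt _ j.val_lt hij)
  next i := by
    rw [h.next _ i.val_lt, ZMod.val_add, ZMod.val_natCast, Nat.add_mod_mod]

lemma natCast_mul_eq_zero (h : IsNecklaceLabelling c M s u lab) (j : ℕ) :
    (j : ZMod M) * (u : ZMod M) = 0 ↔ 3 * c + 1 ∣ j := by
  rw [← Nat.cast_mul, ZMod.natCast_eq_zero_iff, h.period]

lemma isClockwiseNecklace [NeZero M] (h : IsNecklaceLabelling c M s u lab) :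
    IsClockwiseNecklace M (fun i => (lab i.val).openTile) (fun i => (lab i.val).center) where
  disjoint i j hij := by
    refine disjoint_left.2 ?_
    intro p hi hj
    exact hij (h.isLabelCycle.inj (Label.eq_of_mem_halfOpenTile
      (Label.openTile_subset_halfOpenTile _ hi) (Label.openTile_subset_halfOpenTile _ hj)))
  touching i := by
    have := Label.exists_closure_inter (h.touches _ i.val_lt)
    rwa [← ZMod.val_natCast, Nat.cast_add, ZMod.natCast_zmod_val, Nat.cast_one] at this
  clockwise := by
    obtain ⟨m, rfl, h1, h2, h3⟩ := h.half
    obtain ⟨θ, g1, g2, g3⟩ := exists_clockwise_angles (x := fun i => (lab i).center) h2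
      (fun i hi => by simp only [h1 i hi, Label.center_reflect]) h3
    refine ⟨θ, g1, g2, fun i => ?_⟩
    rw [ZMod.val_natCast, Nat.mod_eq_of_lt i.2]
    exact g3 i

lemma isOpenRegularPolygon (h : IsNecklaceLabelling c M s u lab) {i : ℕ} (hi : i < M) :
    IsOpenRegularPolygon s (lab i).openTile (lab i).center := by
  rcases h.sides i hi with ⟨rfl, h1 | h1⟩ | ⟨rfl, h1⟩
  · exact Label.isOpenRegularPolygon_of_upward h1
  · exact Label.isOpenRegularPolygon_of_downward h1
  · exact Label.isOpenRegularPolygon_of_hexagonal h1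

lemma levelDescription [NeZero M] (h : IsNecklaceLabelling c M s u lab) :
    LevelDescription triMap c M s u (3 * c + 1) 3 (9 * c + 3) := by
  have hc := h.isLabelCycle
  have hk := h.natCast_mul_eq_zero
  have h0 := (hk (3 * c + 1)).2 dvd_rfl
  refine ⟨fun i => (lab i.val).openTile, fun i => (lab i.val).center, ?_, fun i => ⟨⟨_, _, _, rfl⟩,
    h.isOpenRegularPolygon i.val_lt⟩, h.isClockwiseNecklace, fun i => ⟨?_, ?_⟩,
    fun i => ⟨?_, ⟨2 * π / 3, fun p hp => ?_, addOrderOf_two_pi_div_three⟩, fun p hp hne => ?_⟩⟩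
  · rw [Label.levelSet_eq]
    ext p
    rw [mem_ofPred_eq, mem_iUnion]
    constructor
    · rintro ⟨L, hL, hE, hp⟩
      obtain ⟨i, hi, rfl⟩ := h.surj L hL hE
      refine ⟨(i : ZMod M), ?_⟩
      rwa [ZMod.val_natCast, Nat.mod_eq_of_lt hi]
    · rintro ⟨i, hi⟩
      exact ⟨_, h.valid _ i.val_lt, h.energy _ i.val_lt, hi⟩
  · simpa using hc.image_openTile hk i 1
  · have := Label.triMap_center (hc.valid i)
    rwa [hc.next i] at this
  · have := hc.image_openTile hk i (3 * c + 1)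
    rwa [h0, add_zero] at this
  · have := hc.iterate_eq (Label.openTile_subset_halfOpenTile _ hp) (3 * c + 1)
    rwa [h0, add_zero, rot_iterate_three_mul_add_one] at this
  · exact hc.minimalPeriod_eq hk (Label.openTile_subset_halfOpenTile _ hp) hne

lemma exists_index [NeZero M] (h : IsNecklaceLabelling c M s u lab) {L : Label} (hL : L.Valid)
    (hE : L.energy = c) : ∃ i : ZMod M, lab i.val = L := by
  obtain ⟨i, hi, rfl⟩ := h.surj L hL hE
  exact ⟨i, by rw [ZMod.val_natCast, Nat.mod_eq_of_lt hi]⟩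

lemma exists_iterate_cv_eq_zero [NeZero M] (h : IsNecklaceLabelling c M s u lab) {L : Label}
    (hE : L.energy = c) {p : Plane} (hp : p ∈ L.halfOpenTile) (hv : cv p = L.l) :
    ∃ j, cv (triMap^[j] p) = 0 := by
  obtain ⟨i, rfl⟩ := h.exists_index (Label.valid_of_mem_halfOpenTile hp) hE
  have hm : (lab i.val).m ≤ (lab i.val).k + (lab i.val).l + 1 := by
    obtain ⟨⟨h1, h2⟩, -, h3, -⟩ := hp
    rw [hv] at h3
    apply Int.lt_add_one_iff.1
    rw [← Int.cast_lt (R := ℝ)]; push_cast; linarith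
  obtain ⟨j, hj⟩ := h.edge _ i.val_lt hm
  refine ⟨3 * j, ?_⟩
  rw [h.isLabelCycle.cv_iterate_three_mul hp hv]
  rw [← ZMod.val_natCast, Nat.cast_add, ZMod.natCast_zmod_val, Nat.cast_mul] at hj
  exact_mod_cast hj

end IsNecklaceLabelling

lemma mod_eq_ite {a M : ℕ} (h : a < 2 * M) : a % M = if a < M then a else a - M := by
  split_ifs with h'
  · exact Nat.mod_eq_of_lt h'
  · rw [Nat.mod_eq_sub_mod (not_lt.1 h'), Nat.mod_eq_of_lt (by omega)]

/-! ### Odd levels: the necklace of hexagons -/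

/-- The hexagons of the level `2n + 1`, in clockwise order. -/
def hexLabel (n i : ℕ) : Label :=
  if i ≤ n then ⟨i, n - i, n + 1⟩
  else if i ≤ 2 * n + 1 then ⟨n, n - i, 2 * n - i + 1⟩
  else if i < 3 * n + 2 then ⟨3 * n + 1 - i, -n - 1, 2 * n + 1 - i⟩
  else if i ≤ 4 * n + 2 then ⟨3 * n + 1 - i, i - 4 * n - 3, -n - 1⟩
  else if i ≤ 5 * n + 3 then ⟨-n - 1, i - 4 * n - 3, i - 5 * n - 3⟩
  else ⟨i - 6 * n - 4, n, i - 5 * n - 3⟩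

/-- Presents the definition as alternatives linear in i and n, for use by `omega`. The six ranges
are the six sides of the necklace. -/
lemma hexLabel_cases (n i : ℕ) :
    (i ≤ n ∧ (hexLabel n i).k = i ∧ (hexLabel n i).l = n - i ∧ (hexLabel n i).m = n + 1) ∨
    (n < i ∧ i ≤ 2 * n + 1 ∧
      (hexLabel n i).k = n ∧ (hexLabel n i).l = n - i ∧ (hexLabel n i).m = 2 * n - i + 1) ∨
    (2 * n + 1 < i ∧ i < 3 * n + 2 ∧ (hexLabel n i).k = 3 * n + 1 - i ∧
      (hexLabel n i).l = -n - 1 ∧ (hexLabel n i).m = 2 * n + 1 - i) ∨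
    (3 * n + 2 ≤ i ∧ i ≤ 4 * n + 2 ∧ (hexLabel n i).k = 3 * n + 1 - i ∧
      (hexLabel n i).l = i - 4 * n - 3 ∧ (hexLabel n i).m = -n - 1) ∨
    (4 * n + 2 < i ∧ i ≤ 5 * n + 3 ∧ (hexLabel n i).k = -n - 1 ∧
      (hexLabel n i).l = i - 4 * n - 3 ∧ (hexLabel n i).m = i - 5 * n - 3) ∨
    (5 * n + 3 < i ∧ (hexLabel n i).k = i - 6 * n - 4 ∧ (hexLabel n i).l = n ∧
      (hexLabel n i).m = i - 5 * n - 3) := by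
  unfold hexLabel
  split_ifs <;> simp only [true_and, and_true] <;> omega

lemma Label.next_eq_of_nonneg {L L' : Label} (h : 0 ≤ L.l) (hk : L'.k = L.l)
    (hl : L'.l = -L.m) (hm : L'.m = -L.k) : L.next = L' := by
  rw [Label.next, if_pos h, Label.ext_iff]
  exact ⟨hk.symm, hl.symm, hm.symm⟩

lemma Label.next_eq_of_neg {L L' : Label} (h : L.l < 0) (hk : L'.k = L.l)
    (hl : L'.l = -L.m - 1) (hm : L'.m = -L.k - 1) : L.next = L' := by
  rw [Label.next, if_neg (not_le.2 h), Label.ext_iff]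
  exact ⟨hk.symm, hl.symm, hm.symm⟩

/-- A maximum of absolute values equals c when all six linear bounds hold and one of them is
attained; which one is attained tells the side of the necklace. -/
lemma Label.energy_eq_iff {L : Label} {c : ℕ} : L.energy = c ↔
    (-c ≤ L.k - L.l + L.m ∧ L.k - L.l + L.m ≤ c ∧ -c ≤ -L.k + L.l + L.m ∧
      -L.k + L.l + L.m ≤ c ∧ -c - 1 ≤ L.k + L.l + L.m + 1 ∧ L.k + L.l + L.m ≤ c) ∧
    (-c = L.k - L.l + L.m ∨ L.k - L.l + L.m = c ∨ -c = -L.k + L.l + L.m ∨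
      -L.k + L.l + L.m = c ∨ -c - 1 = L.k + L.l + L.m + 1 ∨ L.k + L.l + L.m = c) := by
  simp only [Label.energy, abs]
  omega

lemma Label.touches_iff {L L' : Label} : L.Touches L' ↔
    (L.m = L.k + L.l ∧ ((L'.k = L.k - 1 ∧ L'.l = L.l - 1 ∧ L'.m = L.m) ∨
      (L'.k = L.k ∧ L'.l = L.l - 1 ∧ L'.m = L.m + 1) ∨
      (L'.k = L.k - 1 ∧ L'.l = L.l ∧ L'.m = L.m + 1))) ∨
    (L.m = L.k + L.l + 1 ∧ ((L'.k = L.k + 1 ∧ L'.l = L.l - 1 ∧ L'.m = L.m) ∨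
      (L'.k = L.k + 1 ∧ L'.l = L.l ∧ L'.m = L.m + 1) ∨
      (L'.k = L.k ∧ L'.l = L.l + 1 ∧ L'.m = L.m + 1))) := by
  simp only [Label.Touches, Label.ext_iff]

lemma Label.cu_center (L : Label) :
    cu L.center = ((6 * L.k + 2 * (L.m - L.k - L.l) + 1 : ℤ) : ℝ) / 6 := by
  rw [center, cu_ofUV]; push_cast; ring

lemma Label.cv_center (L : Label) :
    cv L.center = ((6 * L.l + 2 * (L.m - L.k - L.l) + 1 : ℤ) : ℝ) / 6 := by
  rw [center, cv_ofUV]; push_cast; ring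

lemma Label.cu_center_pos_iff {L : Label} :
    0 < cu L.center ↔ 0 < 6 * L.k + 2 * (L.m - L.k - L.l) + 1 := by
  rw [Label.cu_center, div_pos_iff_of_pos_right (by norm_num), Int.cast_pos]

lemma Label.center_cross_iff {L L' : Label} :
    cu L.center * cv L'.center < cv L.center * cu L'.center ↔
      (6 * L.k + 2 * (L.m - L.k - L.l) + 1) * (6 * L'.l + 2 * (L'.m - L'.k - L'.l) + 1) <
      (6 * L.l + 2 * (L.m - L.k - L.l) + 1) * (6 * L'.k + 2 * (L'.m - L'.k - L'.l) + 1) := by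
  rw [← Int.cast_lt (R := ℝ), Label.cu_center, Label.cu_center, Label.cv_center,
    Label.cv_center, Int.cast_mul, Int.cast_mul]
  constructor <;> intro h <;> linarith

lemma hexLabel_valid (n i : ℕ) : (hexLabel n i).m = (hexLabel n i).k + (hexLabel n i).l + 1 := by
  have := hexLabel_cases n i
  omega


lemma hexLabel_energy {n i : ℕ} (hi : i < 6 * n + 4) : (hexLabel n i).energy = (2 * n + 1 : ℕ) := by
  rw [Label.energy_eq_iff]
  push_cast
  rcases hexLabel_cases n i with h | h | h | h | h | h
  · refine ⟨by omega, ?_⟩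
    right; right; right; right; right; omega
  · refine ⟨by omega, ?_⟩
    right; left; omega
  · refine ⟨by omega, ?_⟩
    right; right; left; omega
  · refine ⟨by omega, ?_⟩
    right; right; right; right; left; omega
  · refine ⟨by omega, ?_⟩
    left; omega
  · refine ⟨by omega, ?_⟩
    right; right; right; left; omega

lemma hexLabel_surj {n : ℕ} {L : Label} (hL : L.Valid) (hE : L.energy = (2 * n + 1 : ℕ)) :
    ∃ i < 6 * n + 4, hexLabel n i = L := by
  rw [Label.energy_eq_iff] at hE
  push_cast at hE
  unfold Label.Valid at hL
  -- The attained bound has the parity of the excess, so an odd energy excludes triangles.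
  have hm : L.m = L.k + L.l + 1 := by omega
  rw [hm] at hE
  have key : ∀ i : ℕ, i < 6 * n + 4 → (hexLabel n i).k = L.k → (hexLabel n i).l = L.l →
      ∃ i < 6 * n + 4, hexLabel n i = L := fun i h1 h2 h3 =>
    ⟨i, h1, Label.ext h2 h3 (by rw [hm, hexLabel_valid, h2, h3])⟩
  obtain ⟨hE, h | h | h | h | h | h⟩ := hE
  · rcases le_or_gt 0 L.l with h' | h'
    · apply key (L.l + 4 * n + 3).toNat (by omega)
      all_goals
        rcases hexLabel_cases n (L.l + 4 * n + 3).toNat with g | g | g | g | g | g <;> omega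
    -- Only a corner tile is left here; it is indexed with the preceding side.
    · apply key (3 * n + 1 - L.k).toNat (by omega)
      all_goals
        rcases hexLabel_cases n (3 * n + 1 - L.k).toNat with g | g | g | g | g | g <;> omega
  · apply key (n - L.l).toNat (by omega)
    all_goals rcases hexLabel_cases n (n - L.l).toNat with g | g | g | g | g | g <;> omega
  · apply key (3 * n + 1 - L.k).toNat (by omega)
    all_goals rcases hexLabel_cases n (3 * n + 1 - L.k).toNat with g | g | g | g | g | g <;> omega
  · rcases le_or_gt 0 L.k with h' | h'
    · apply key L.k.toNat (by omega)
      all_goals rcases hexLabel_cases n L.k.toNat with g | g | g | g | g | g <;> omega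
    · apply key (L.k + 6 * n + 4).toNat (by omega)
      all_goals
        rcases hexLabel_cases n (L.k + 6 * n + 4).toNat with g | g | g | g | g | g <;> omega
  · apply key (3 * n + 1 - L.k).toNat (by omega)
    all_goals rcases hexLabel_cases n (3 * n + 1 - L.k).toNat with g | g | g | g | g | g <;> omega
  · apply key L.k.toNat (by omega)
    all_goals rcases hexLabel_cases n L.k.toNat with g | g | g | g | g | g <;> omega

lemma hexLabel_inj {n i j : ℕ} (hi : i < 6 * n + 4) (hj : j < 6 * n + 4)
    (hij : hexLabel n i = hexLabel n j) : i = j := by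
  rw [Label.ext_iff] at hij
  rcases hexLabel_cases n i with h | h | h | h | h | h <;>
    rcases hexLabel_cases n j with g | g | g | g | g | g <;> omega

/-- The reduction modulo 6n + 4 is given as a disjunction, to stay within linear arithmetic. -/
lemma hexLabel_next {n i j : ℕ} (hi : i < 6 * n + 4) (hj : j < 6 * n + 4)
    (hij : j = i + (2 * n + 1) ∨ i + (2 * n + 1) = j + (6 * n + 4)) :
    (hexLabel n i).next = hexLabel n j := by
  rcases hexLabel_cases n i with h | h | h | h | h | h <;>
    rcases hexLabel_cases n j with g | g | g | g | g | g <;>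
    first
    | exfalso; omega
    | apply Label.next_eq_of_nonneg <;> omega
    | apply Label.next_eq_of_neg <;> omega
lemma hexLabel_touches {n i j : ℕ} (hi : i < 6 * n + 4) (hj : j < 6 * n + 4)
    (hij : j = i + 1 ∨ i + 1 = j + (6 * n + 4)) :
    (hexLabel n i).Touches (hexLabel n j) ∨ (hexLabel n j).Touches (hexLabel n i) := by
  rw [Label.touches_iff, Label.touches_iff]
  rcases hexLabel_cases n i with h | h | h | h | h | h <;>
    rcases hexLabel_cases n j with g | g | g | g | g | g <;>
    first
    | exfalso; omega
    | exact .inl (.inr ⟨by omega, .inl (by omega)⟩)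
    | exact .inr (.inr ⟨by omega, .inr (.inr (by omega))⟩)
    | exact .inr (.inr ⟨by omega, .inr (.inl (by omega))⟩)
    | exact .inr (.inr ⟨by omega, .inl (by omega)⟩)
    | exact .inl (.inr ⟨by omega, .inr (.inr (by omega))⟩)
    | exact .inl (.inr ⟨by omega, .inr (.inl (by omega))⟩)

lemma hexLabel_reflect {n i : ℕ} (hi : i < 3 * n + 2) :
    hexLabel n (i + (3 * n + 2)) = (hexLabel n i).reflect := by
  rw [Label.ext_iff]
  simp only [Label.reflect]
  rcases hexLabel_cases n i with h | h | h | h | h | h <;>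
    rcases hexLabel_cases n (i + (3 * n + 2)) with g | g | g | g | g | g <;>
    first
    | exfalso; omega
    | refine ⟨?_, ?_, ?_⟩ <;> omega

lemma hexLabel_center_pos {n i : ℕ} (hi : i < 3 * n + 2) : 0 < cu (hexLabel n i).center := by
  rw [Label.cu_center_pos_iff]
  rcases hexLabel_cases n i with h | h | h | h | h | h <;> omega

lemma hexLabel_center_cross {n i : ℕ} (hi : i + 1 < 3 * n + 2) :
    cu (hexLabel n i).center * cv (hexLabel n (i + 1)).center <
      cv (hexLabel n i).center * cu (hexLabel n (i + 1)).center := by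
  rw [Label.center_cross_iff]
  rcases hexLabel_cases n i with ⟨h1, h2, h3, h4⟩ | ⟨h0, h1, h2, h3, h4⟩ |
      ⟨h0, h1, h2, h3, h4⟩ | h | h | h <;>
    rcases hexLabel_cases n (i + 1) with ⟨g1, g2, g3, g4⟩ | ⟨g0, g1, g2, g3, g4⟩ |
      ⟨g0, g1, g2, g3, g4⟩ | h' | h' | h' <;>
    first
    | exfalso; omega
    | rw [h2, h3, h4, g2, g3, g4]
      push_cast
      zify at *
      nlinarith

theorem hexLabel_isNecklaceLabelling (n : ℕ) : IsNecklaceLabelling (2 * n + 1)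
    (3 * (2 * n + 1) + 1) 6 (2 * n + 1) (hexLabel n) where
  valid i _ := by
    have := hexLabel_valid n i
    unfold Label.Valid; omega
  energy i hi := hexLabel_energy (by omega)
  surj L hL hE := by
    rw [show 3 * (2 * n + 1) + 1 = 6 * n + 4 by ring]
    exact hexLabel_surj hL hE
  inj i hi j hj hij := hexLabel_inj (n := n) (by omega) (by omega) hij
  next i hi := by
    rw [mod_eq_ite (by omega)]
    apply hexLabel_next (by omega) <;> split_ifs <;> omega
  touches i hi := by
    rw [mod_eq_ite (by omega)]
    apply hexLabel_touches (by omega) <;> split_ifs <;> omega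
  sides i _ := .inr ⟨rfl, hexLabel_valid n i⟩
  half := ⟨3 * n + 2, by ring, fun _ hi => hexLabel_reflect hi, fun _ hi => hexLabel_center_pos hi,
    fun _ hi => hexLabel_center_cross hi⟩
  period j := by
    rw [Nat.Coprime.dvd_mul_right]
    rw [Nat.coprime_mul_right_add_left]
    exact Nat.coprime_one_left _
  edge i hi _ := by
    -- Since 3u ≡ -1 modulo M = 3u + 1, the number of triple steps from i to n is i - n; adding M
    -- keeps it natural. The tile of index n has l = 0.
    refine ⟨i + (3 * (2 * n + 1) + 1) - n, ?_⟩
    have : (i + 3 * (i + (3 * (2 * n + 1) + 1) - n) * (2 * n + 1)) % (3 * (2 * n + 1) + 1) = n := by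
      obtain ⟨j, hj⟩ : ∃ j, i + (3 * (2 * n + 1) + 1) - n = j + 1 := ⟨i + 5 * n + 3, by omega⟩
      have hi : i + 5 * n + 3 = j := by omega
      rw [hj, show i + 3 * (j + 1) * (2 * n + 1) = n + (3 * (2 * n + 1) + 1) * j by
        subst hi; ring, Nat.add_mul_mod_self_left, Nat.mod_eq_of_lt (by omega)]
    rw [this]
    have := hexLabel_cases n n
    omega

/-! ### Even levels: the necklace of triangles -/

/-- The triangles of the level `2n`, in clockwise order; the index is `2q + r` with `r ≤ 1`. -/
def triLabel (n q r : ℕ) : Label :=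
  if q + r ≤ n then ⟨q, n - q - r, n + r⟩
  else if q ≤ 2 * n then ⟨n - r, n - q - r, 2 * n - q⟩
  else if q < 3 * n + 1 - r then ⟨3 * n - q - r, -n - r, 2 * n - q⟩
  else if q ≤ 4 * n then ⟨3 * n - q - r, q - 4 * n - 1, -n - 1 + r⟩
  else if q + r ≤ 5 * n + 1 then ⟨-n - r, q - 4 * n - 1, q + r - 5 * n - 1⟩
  else ⟨q - 6 * n - 1, n - r, q + r - 5 * n - 1⟩


lemma triLabel_cases (n q : ℕ) {r : ℕ} (hr : r ≤ 1) :
    (q + r ≤ n ∧ (triLabel n q r).k = q ∧ (triLabel n q r).l = n - q - r ∧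
      (triLabel n q r).m = n + r) ∨
    (n < q + r ∧ q ≤ 2 * n ∧ (triLabel n q r).k = n - r ∧ (triLabel n q r).l = n - q - r ∧
      (triLabel n q r).m = 2 * n - q) ∨
    (2 * n < q ∧ q + r < 3 * n + 1 ∧ (triLabel n q r).k = 3 * n - q - r ∧
      (triLabel n q r).l = -n - r ∧ (triLabel n q r).m = 2 * n - q) ∨
    (3 * n + 1 ≤ q + r ∧ q ≤ 4 * n ∧ (triLabel n q r).k = 3 * n - q - r ∧
      (triLabel n q r).l = q - 4 * n - 1 ∧ (triLabel n q r).m = -n - 1 + r) ∨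
    (4 * n < q ∧ q + r ≤ 5 * n + 1 ∧ (triLabel n q r).k = -n - r ∧
      (triLabel n q r).l = q - 4 * n - 1 ∧ (triLabel n q r).m = q + r - 5 * n - 1) ∨
    (5 * n + 1 < q + r ∧ (triLabel n q r).k = q - 6 * n - 1 ∧ (triLabel n q r).l = n - r ∧
      (triLabel n q r).m = q + r - 5 * n - 1) := by
  unfold triLabel
  split_ifs <;> simp only [true_and, and_true] <;> omega

lemma triLabel_m (n q : ℕ) {r : ℕ} (hr : r ≤ 1) :
    (triLabel n q r).m = (triLabel n q r).k + (triLabel n q r).l + 2 * r := by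
  have := triLabel_cases n q hr
  omega

lemma triLabel_energy {n q r : ℕ} (hr : r ≤ 1) (hq : q < 6 * n + 1) :
    (triLabel n q r).energy = (2 * n : ℕ) := by
  rw [Label.energy_eq_iff]
  push_cast
  rcases triLabel_cases n q hr with h | h | h | h | h | h
  · refine ⟨by omega, ?_⟩
    right; right; right; right; right; omega
  · refine ⟨by omega, ?_⟩
    right; left; omega
  · refine ⟨by omega, ?_⟩
    right; right; left; omega
  · refine ⟨by omega, ?_⟩
    right; right; right; right; left; omega
  · refine ⟨by omega, ?_⟩
    left; omega
  · refine ⟨by omega, ?_⟩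
    right; right; right; left; omega

lemma triLabel_surj {n : ℕ} {L : Label} (hL : L.Valid) (hE : L.energy = (2 * n : ℕ)) :
    ∃ q < 6 * n + 1, ∃ r ≤ 1, triLabel n q r = L := by
  rw [Label.energy_eq_iff] at hE
  push_cast at hE
  unfold Label.Valid at hL
  -- Even energy forces even excess 2r, and r tells upward from downward triangles.
  obtain ⟨r, hr, hm⟩ : ∃ r : ℕ, r ≤ 1 ∧ L.m = L.k + L.l + 2 * r :=
    ⟨((L.m - L.k - L.l) / 2).toNat, by omega, by omega⟩
  rw [hm] at hE
  have key : ∀ q : ℕ, q < 6 * n + 1 → (triLabel n q r).k = L.k → (triLabel n q r).l = L.l →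
      ∃ q < 6 * n + 1, ∃ r ≤ 1, triLabel n q r = L := fun q h1 h2 h3 =>
    ⟨q, h1, r, hr, Label.ext h2 h3 (by rw [hm, triLabel_m n q hr, h2, h3])⟩
  -- At level 0 there are just two triangles, both with q = 0; some of the index formulas below
  -- would leave the range.
  rcases Nat.eq_zero_or_pos n with h0 | h0
  · apply key 0 (by omega)
    all_goals rcases triLabel_cases n 0 hr with g | g | g | g | g | g <;> omega
  obtain ⟨hE, h | h | h | h | h | h⟩ := hE
  · rcases le_or_gt 0 L.l with h' | h'
    · apply key (L.l + 4 * n + 1).toNat (by omega)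
      all_goals
        rcases triLabel_cases n (L.l + 4 * n + 1).toNat hr with g | g | g | g | g | g <;> omega
    · apply key (3 * n - r - L.k).toNat (by omega)
      all_goals
        rcases triLabel_cases n (3 * n - r - L.k).toNat hr with g | g | g | g | g | g <;> omega
  · apply key (n - r - L.l).toNat (by omega)
    all_goals rcases triLabel_cases n (n - r - L.l).toNat hr with g | g | g | g | g | g <;> omega
  · apply key (3 * n - r - L.k).toNat (by omega)
    all_goals
      rcases triLabel_cases n (3 * n - r - L.k).toNat hr with g | g | g | g | g | g <;> omega
  · rcases le_or_gt 0 L.k with h' | h'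
    · apply key L.k.toNat (by omega)
      all_goals rcases triLabel_cases n L.k.toNat hr with g | g | g | g | g | g <;> omega
    · apply key (L.k + 6 * n + 1).toNat (by omega)
      all_goals
        rcases triLabel_cases n (L.k + 6 * n + 1).toNat hr with g | g | g | g | g | g <;> omega
  · apply key (3 * n - r - L.k).toNat (by omega)
    all_goals
      rcases triLabel_cases n (3 * n - r - L.k).toNat hr with g | g | g | g | g | g <;> omega
  · apply key L.k.toNat (by omega)
    all_goals rcases triLabel_cases n L.k.toNat hr with g | g | g | g | g | g <;> omega

lemma triLabel_inj {n q r q' r' : ℕ} (hr : r ≤ 1) (hr' : r' ≤ 1) (hq : q < 6 * n + 1)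
    (hq' : q' < 6 * n + 1) (h : triLabel n q r = triLabel n q' r') : q = q' ∧ r = r' := by
  have e : r = r' := by
    have h1 := triLabel_m n q hr
    have h2 := triLabel_m n q' hr'
    rw [h] at h1
    omega
  subst e
  rw [Label.ext_iff] at h
  refine ⟨?_, rfl⟩
  rcases triLabel_cases n q hr with g | g | g | g | g | g <;>
    rcases triLabel_cases n q' hr with g' | g' | g' | g' | g' | g' <;> omega

lemma triLabel_next {n q r q' : ℕ} (hr : r ≤ 1) (hq : q < 6 * n + 1) (hq' : q' < 6 * n + 1)
    (h : q' = q + 2 * n ∨ q + 2 * n = q' + (6 * n + 1)) :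
    (triLabel n q r).next = triLabel n q' r := by
  rcases triLabel_cases n q hr with g | g | g | g | g | g <;>
    rcases triLabel_cases n q' hr with g' | g' | g' | g' | g' | g' <;>
    first
    | exfalso; omega
    | apply Label.next_eq_of_nonneg <;> omega
    | apply Label.next_eq_of_neg <;> omega

lemma triLabel_touches_one {n q : ℕ} (hq : q < 6 * n + 1) :
    (triLabel n q 0).Touches (triLabel n q 1) := by
  rw [Label.touches_iff]
  rcases triLabel_cases n q zero_le_one with g | g | g | g | g | g <;>
    rcases triLabel_cases n q le_rfl with g' | g' | g' | g' | g' | g' <;>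
    first
    | exfalso; omega
    | exact .inl ⟨by omega, .inl (by omega)⟩
    | exact .inl ⟨by omega, .inr (.inl (by omega))⟩
    | exact .inl ⟨by omega, .inr (.inr (by omega))⟩

lemma triLabel_touches_zero {n q q' : ℕ} (hq : q < 6 * n + 1) (hq' : q' < 6 * n + 1)
    (h : q' = q + 1 ∨ q = q' + 6 * n) : (triLabel n q' 0).Touches (triLabel n q 1) := by
  rw [Label.touches_iff]
  rcases triLabel_cases n q' zero_le_one with g | g | g | g | g | g <;>
    rcases triLabel_cases n q le_rfl with g' | g' | g' | g' | g' | g' <;>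
    first
    | exfalso; omega
    | exact .inl ⟨by omega, .inl (by omega)⟩
    | exact .inl ⟨by omega, .inr (.inl (by omega))⟩
    | exact .inl ⟨by omega, .inr (.inr (by omega))⟩

/-- Half a turn of the necklace is an odd shift, 6n + 1, so it exchanges upward and downward
triangles. -/
lemma triLabel_reflect {n q r q' r' : ℕ} (hq : 2 * q + r < 6 * n + 1) (hr : r + r' = 1)
    (hq' : q' = q + 3 * n + r) : triLabel n q' r' = (triLabel n q r).reflect := by
  rw [Label.ext_iff]
  simp only [Label.reflect]
  rcases triLabel_cases n q (show r ≤ 1 by omega) with g | g | g | g | g | g <;>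
    rcases triLabel_cases n q' (show r' ≤ 1 by omega) with g' | g' | g' | g' | g' | g' <;>
    first
    | exfalso; omega
    | refine ⟨?_, ?_, ?_⟩ <;> omega

lemma triLabel_center_pos {n q r : ℕ} (hr : r ≤ 1) (hq : 2 * q + r < 6 * n + 1) :
    0 < cu (triLabel n q r).center := by
  rw [Label.cu_center_pos_iff]
  rcases triLabel_cases n q hr with h | h | h | h | h | h <;> omega

lemma triLabel_center_cross {n q r q' r' : ℕ} (hr : r + r' = 1) (hq : 2 * q + r < 6 * n)
    (hq' : q' = q + r) :
    cu (triLabel n q r).center * cv (triLabel n q' r').center <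
      cv (triLabel n q r).center * cu (triLabel n q' r').center := by
  rw [Label.center_cross_iff]
  rcases triLabel_cases n q (show r ≤ 1 by omega) with ⟨h1, h2, h3, h4⟩ | ⟨h0, h1, h2, h3, h4⟩ |
      ⟨h0, h1, h2, h3, h4⟩ | h | h | h <;>
    rcases triLabel_cases n q' (show r' ≤ 1 by omega) with ⟨g1, g2, g3, g4⟩ |
      ⟨g0, g1, g2, g3, g4⟩ | ⟨g0, g1, g2, g3, g4⟩ | h' | h' | h' <;>
    first
    | exfalso; omega
    | rw [h2, h3, h4, g2, g3, g4]
      obtain ⟨rfl, rfl⟩ | ⟨rfl, rfl⟩ : r = 0 ∧ r' = 1 ∨ r = 1 ∧ r' = 0 := by omega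
      all_goals
        push_cast
        zify at *
        rw [hq']
        nlinarith

theorem triLabel_isNecklaceLabelling (n : ℕ) : IsNecklaceLabelling (2 * n)
    (6 * (2 * n) + 2) 3 (2 * (2 * n)) (fun i => triLabel n (i / 2) (i % 2)) where
  valid i _ := by
    have := triLabel_m n (i / 2) (show i % 2 ≤ 1 by omega)
    unfold Label.Valid; omega
  energy i hi := triLabel_energy (by omega) (by omega)
  surj L hL hE := by
    obtain ⟨q, hq, r, hr, h⟩ := triLabel_surj hL hE
    refine ⟨2 * q + r, by omega, ?_⟩
    rw [show (2 * q + r) / 2 = q by omega, show (2 * q + r) % 2 = r by omega, h]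
  inj i hi j hj hij := by
    have := triLabel_inj (by omega) (by omega) (by omega) (by omega) hij
    omega
  next i hi := by
    rw [mod_eq_ite (a := i + 2 * (2 * n)) (by omega)]
    split_ifs with h
    · rw [show (i + 2 * (2 * n)) % 2 = i % 2 by omega]
      apply triLabel_next <;> omega
    · rw [show (i + 2 * (2 * n) - (6 * (2 * n) + 2)) % 2 = i % 2 by omega]
      apply triLabel_next <;> omega
  touches i hi := by
    rw [mod_eq_ite (a := i + 1) (by omega)]
    rcases Nat.mod_two_eq_zero_or_one i with h0 | h0
    · rw [if_pos (by omega), h0, show (i + 1) / 2 = i / 2 by omega,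
        show (i + 1) % 2 = 1 by omega]
      exact .inl (triLabel_touches_one (by omega))
    · right
      rw [h0]
      split_ifs with h
      · rw [show (i + 1) % 2 = 0 by omega]
        apply triLabel_touches_zero <;> omega
      · rw [show (i + 1 - (6 * (2 * n) + 2)) % 2 = 0 by omega]
        apply triLabel_touches_zero <;> omega
  sides i _ := by
    have := triLabel_m n (i / 2) (show i % 2 ≤ 1 by omega)
    left
    omega
  half := by
    refine ⟨6 * n + 1, by ring, fun i hi => ?_, fun i hi => ?_, fun i hi => ?_⟩
    · apply triLabel_reflect <;> omega
    · apply triLabel_center_pos <;> omega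
    · apply triLabel_center_cross <;> omega
  period j := by
    rw [show 6 * (2 * n) + 2 = 2 * (3 * (2 * n) + 1) by ring,
      show j * (2 * (2 * n)) = 2 * (j * (2 * n)) by ring, Nat.mul_dvd_mul_iff_left two_pos,
      Nat.Coprime.dvd_mul_right]
    rw [Nat.coprime_mul_right_add_left]
    exact Nat.coprime_one_left _
  edge i hi hm := by
    have h0 := triLabel_m n (i / 2) (show i % 2 ≤ 1 by omega)
    obtain ⟨q, rfl⟩ : ∃ q, i = 2 * q := ⟨i / 2, by omega⟩
    -- Now 3u ≡ -2 modulo M, so q - n triple steps lead from index 2q to 2n, an upward triangle with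
    -- l = 0; here q - n is replaced by q - n + (6n + 1), where 6n + 1 = M/2.
    refine ⟨q + 5 * n + 1, ?_⟩
    rw [show 2 * q + 3 * (q + 5 * n + 1) * (2 * (2 * n)) =
      2 * n + (6 * (2 * n) + 2) * (q + 5 * n) by ring, Nat.add_mul_mod_self_left,
      Nat.mod_eq_of_lt (by omega), show 2 * n / 2 = n by omega, show 2 * n % 2 = 0 by omega]
    have := triLabel_cases n n zero_le_one
    omega

/-! ### Periods, critical set and first integral -/

theorem Label.exists_isNecklaceLabelling (c : ℕ) : ∃ M s u lab, M ≠ 0 ∧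
    IsNecklaceLabelling c M s u lab := by
  obtain ⟨n, rfl | rfl⟩ := Nat.even_or_odd' c
  · exact ⟨_, _, _, _, by omega, triLabel_isNecklaceLabelling n⟩
  · exact ⟨_, _, _, _, by omega, hexLabel_isNecklaceLabelling n⟩

lemma Label.exists_energy_eq (L : Label) : ∃ c : ℕ, L.energy = c := by
  have h : 0 ≤ L.energy := (abs_nonneg _).trans (le_max_left _ _)
  exact ⟨L.energy.toNat, (Int.toNat_of_nonneg h).symm⟩

lemma mem_periodicPts_triMap (p : Plane) : p ∈ periodicPts triMap := by
  obtain ⟨L, hL, hp⟩ := Label.exists_mem_halfOpenTile p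
  obtain ⟨c, hc⟩ := L.exists_energy_eq
  obtain ⟨M, s, u, lab, hM, h⟩ := Label.exists_isNecklaceLabelling c
  have : NeZero M := ⟨hM⟩
  obtain ⟨i, rfl⟩ := h.exists_index hL hc
  exact h.isLabelCycle.mem_periodicPts h.natCast_mul_eq_zero hp

lemma minimalPeriod_center {L : Label} (hL : L.Valid) {c : ℕ} (hc : L.energy = c) :
    minimalPeriod triMap L.center = 3 * c + 1 := by
  obtain ⟨M, s, u, lab, hM, h⟩ := Label.exists_isNecklaceLabelling c
  have : NeZero M := ⟨hM⟩
  obtain ⟨i, rfl⟩ := h.exists_index hL hc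
  exact h.isLabelCycle.minimalPeriod_center h.natCast_mul_eq_zero i

lemma minimalPeriod_eq_of_ne_center {L : Label} {c : ℕ} (hc : L.energy = c) {p : Plane}
    (hp : p ∈ L.halfOpenTile) (hne : p ≠ L.center) :
    minimalPeriod triMap p = 9 * c + 3 := by
  obtain ⟨M, s, u, lab, hM, h⟩ := Label.exists_isNecklaceLabelling c
  have : NeZero M := ⟨hM⟩
  obtain ⟨i, rfl⟩ := h.exists_index (Label.valid_of_mem_halfOpenTile hp) hc
  exact h.isLabelCycle.minimalPeriod_eq h.natCast_mul_eq_zero hp hne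

lemma Label.exists_valid_energy_eq (c : ℕ) : ∃ L : Label, L.Valid ∧ L.energy = c := by
  obtain ⟨M, s, u, lab, hM, h⟩ := Label.exists_isNecklaceLabelling c
  exact ⟨lab 0, h.valid 0 (Nat.pos_of_ne_zero hM), h.energy 0 (Nat.pos_of_ne_zero hM)⟩

lemma Label.exists_mem_openTile_ne_center {L : Label} (hL : L.Valid) :
    ∃ p ∈ L.openTile, p ≠ L.center := by
  -- This displacement keeps w, and 1/12 is less than 1/6, the least distance in u or v from a
  -- center to the bounds of its label.
  refine ⟨L.center + ofUV (1 / 12) (-(1 / 12)), ?_, ?_⟩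
  · have h1 : (L.k + L.l : ℝ) ≤ L.m := by exact_mod_cast hL.1
    have h2 : (L.m : ℝ) ≤ L.k + L.l + 2 := by exact_mod_cast hL.2
    rw [mem_openTile, center, cu_add, cv_add, cu_ofUV, cv_ofUV, cu_ofUV, cv_ofUV]
    refine ⟨⟨?_, ?_⟩, ⟨?_, ?_⟩, ?_, ?_⟩ <;> linarith
  · intro h
    have := congrArg cu h
    rw [cu_add, cu_ofUV] at this
    linarith

lemma mapsTo_triMap_zeroFree : MapsTo triMap zeroFree zeroFree := by
  intro p hp
  obtain ⟨L, -, hL⟩ := Label.exists_mem_openTile hp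
  exact Label.openTile_subset_zeroFree _ (Label.triMap_mem_openTile hL)

lemma exists_iterate_cv_eq_zero_of_cv_eq {p : Plane} {l : ℤ} (hv : cv p = l) :
    ∃ j, cv (triMap^[j] p) = 0 := by
  obtain ⟨L, hL, hp⟩ := Label.exists_mem_halfOpenTile p
  obtain ⟨c, hc⟩ := L.exists_energy_eq
  obtain ⟨M, s, u, lab, hM, h⟩ := Label.exists_isNecklaceLabelling c
  have : NeZero M := ⟨hM⟩
  refine h.exists_iterate_cv_eq_zero hc hp ?_
  obtain ⟨-, ⟨h1, h2⟩, -⟩ := hp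
  rw [hv] at h1 h2 ⊢
  norm_cast at h1 h2 ⊢
  omega

lemma cv_triMap (p : Plane) : cv (triMap p) = 1 - (cu p + cv p + 1 / 2) ∨
    cv (triMap p) = -(cu p + cv p + 1 / 2) := by
  rcases le_or_gt 0 (cv p) with h | h
  · left; rw [cv_triMap_of_nonneg h]; ring
  · right; rw [cv_triMap_of_neg h]; ring

lemma exists_iterate_cv_eq_zero_of_mem_grid {p : Plane} (hp : p ∈ grid) :
    ∃ j, cv (triMap^[j] p) = 0 := by
  have h : p ∉ zeroFree := not_not.2 hp
  rw [Label.mem_zeroFree_iff] at h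
  by_cases hv : ∃ l : ℤ, cv p = l
  · obtain ⟨l, hl⟩ := hv
    exact exists_iterate_cv_eq_zero_of_cv_eq hl
  by_cases hw : ∃ m : ℤ, cu p + cv p + 1 / 2 = m
  · obtain ⟨m, hm⟩ := hw
    obtain ⟨l, hl⟩ : ∃ l : ℤ, cv (triMap p) = l := by
      rcases cv_triMap p with h' | h' <;> rw [hm] at h'
      · exact ⟨1 - m, by rw [h']; push_cast; ring⟩
      · exact ⟨-m, by rw [h']; push_cast; ring⟩
    obtain ⟨j, hj⟩ := exists_iterate_cv_eq_zero_of_cv_eq hl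
    exact ⟨j + 1, hj⟩
  obtain ⟨k, hk⟩ : ∃ k : ℤ, cu p = k := by
    by_contra hu
    push Not at hu hv hw
    exact h ⟨hu, hv, hw⟩
  -- After two steps the coordinate v equals the original u up to an integer.
  obtain ⟨l, hl⟩ : ∃ l : ℤ, cv (triMap (triMap p)) = l := by
    rcases cv_triMap p with h1 | h1 <;> rcases cv_triMap (triMap p) with h2 | h2 <;>
      rw [cu_triMap, h1, hk] at h2
    · exact ⟨k, by rw [h2]; ring⟩
    · exact ⟨k - 1, by rw [h2]; push_cast; ring⟩
    · exact ⟨k + 1, by rw [h2]; push_cast; ring⟩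
    · exact ⟨k, by rw [h2]; ring⟩
  obtain ⟨j, hj⟩ := exists_iterate_cv_eq_zero_of_cv_eq hl
  exact ⟨j + 2, hj⟩

lemma mem_grid_of_mem_criticalLine {p : Plane} {i : ℕ} (hp : p ∈ criticalLine (2 * π / 3) i) :
    p ∈ grid := by
  by_contra h
  have h1 : triMap^[i] p ∈ zeroFree := mapsTo_triMap_zeroFree.iterate i h
  have h2 : cv (triMap^[i] p) = 0 := (cv_eq_zero_iff _).2 hp
  exact (Label.mem_zeroFree_iff.1 h1).2.1 0 (by simpa using h2)

lemma exists_mem_criticalLine_succ {p : Plane} (hp : p ∈ grid) :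
    ∃ i, p ∈ criticalLine (2 * π / 3) (i + 1) := by
  obtain ⟨j, hj⟩ := exists_iterate_cv_eq_zero_of_mem_grid hp
  obtain ⟨N, hN, hpN⟩ := mem_periodicPts_triMap p
  -- One more period N makes the index of the critical line at least 1.
  refine ⟨j + (N - 1), ?_⟩
  have : triMap^[j + (N - 1) + 1] p = triMap^[j] p := by
    rw [add_assoc, Nat.sub_add_cancel hN, iterate_add_apply, hpN.eq]
  exact (cv_eq_zero_iff _).1 (this ▸ hj)

lemma iUnion_criticalLine_succ : (⋃ i : ℕ, criticalLine (2 * π / 3) (i + 1)) = grid := by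
  ext p
  rw [mem_iUnion]
  exact ⟨fun ⟨_, hi⟩ => mem_grid_of_mem_criticalLine hi, exists_mem_criticalLine_succ⟩

lemma criticalSet_eq_grid : criticalSet (2 * π / 3) = grid := by
  ext p
  rw [criticalSet, mem_iUnion]
  exact ⟨fun ⟨_, hi⟩ => mem_grid_of_mem_criticalLine hi,
    fun h => (exists_mem_criticalLine_succ h).imp' _ fun _ => id⟩

lemma funV_image_zeroFree : funV '' zeroFree = range (fun c : ℕ => (c : ℝ)) := by
  ext y
  constructor
  · rintro ⟨p, hp, rfl⟩
    obtain ⟨L, -, hL⟩ := Label.exists_mem_openTile hp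
    obtain ⟨c, hc⟩ := L.exists_energy_eq
    exact ⟨c, by rw [Label.funV_eq_energy hL, hc]; simp⟩
  · rintro ⟨c, rfl⟩
    obtain ⟨L, hL, hc⟩ := Label.exists_valid_energy_eq c
    have h := Label.center_mem_openTile hL
    exact ⟨_, Label.openTile_subset_zeroFree _ h, by rw [Label.funV_eq_energy h, hc]; simp⟩

lemma isFirstIntegralOn_funV : IsFirstIntegralOn triMap zeroFree funV := by
  refine ⟨mapsTo_triMap_zeroFree, fun p hp => ?_, ?_⟩
  · obtain ⟨L, hL, hp⟩ := Label.exists_mem_openTile hp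
    rw [Label.funV_eq_energy hp, Label.funV_eq_energy (Label.triMap_mem_openTile hp), Label.energy_next hL]
  · have h : ∀ c : ℕ, ∃ p ∈ zeroFree, funV p = c := fun c => by
      have : (c : ℝ) ∈ funV '' zeroFree := funV_image_zeroFree ▸ mem_range_self c
      exact this
    obtain ⟨p, hp, hp0⟩ := h 0
    obtain ⟨q, hq, hq1⟩ := h 1
    exact ⟨p, hp, q, hq, by rw [hp0, hq1]; norm_num⟩

/-- Two points with the same image agree after a common period, hence coincide; a preimage is found
one step before the end of a period. -/
lemma isPointwisePeriodic_of_forall_mem_periodicPts {f : Plane → Plane}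
    (h : ∀ p, p ∈ periodicPts f) : IsPointwisePeriodic f := by
  refine ⟨⟨fun p q hpq => ?_, fun p => ?_⟩, h⟩
  · obtain ⟨m, hm, hpm⟩ := h p
    obtain ⟨n, hn, hqn⟩ := h q
    have hp := hpm.mul_const n
    have hq := hqn.const_mul m
    obtain ⟨k, hk⟩ : ∃ k, m * n = k + 1 := ⟨m * n - 1, by
      have := Nat.mul_pos hm hn; omega⟩
    rw [← hp.eq, ← hq.eq, hk, iterate_succ_apply, iterate_succ_apply, hpq]
  · obtain ⟨m, hm, hpm⟩ := h p
    refine ⟨f^[m - 1] p, ?_⟩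
    rw [← iterate_succ_apply' f, Nat.succ_eq_add_one, Nat.sub_add_cancel hm, hpm.eq]

lemma setOfPeriods_triMap : setOfPeriods triMap =
    {N | (∃ n : ℕ, N = 3 * n + 1) ∨ (∃ n : ℕ, N = 9 * n + 3)} := by
  ext N
  constructor
  · rintro ⟨p, -, rfl⟩
    obtain ⟨L, hL, hp⟩ := Label.exists_mem_halfOpenTile p
    obtain ⟨c, hc⟩ := L.exists_energy_eq
    by_cases hne : p = L.center
    · exact .inl ⟨c, hne ▸ minimalPeriod_center hL hc⟩
    · exact .inr ⟨c, minimalPeriod_eq_of_ne_center hc hp hne⟩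
  · rintro (⟨c, rfl⟩ | ⟨c, rfl⟩) <;> obtain ⟨L, hL, hc⟩ := Label.exists_valid_energy_eq c
    · exact ⟨_, mem_periodicPts_triMap _, minimalPeriod_center hL hc⟩
    · obtain ⟨p, hp, hne⟩ := Label.exists_mem_openTile_ne_center hL
      exact ⟨p, mem_periodicPts_triMap _,
        minimalPeriod_eq_of_ne_center hc (Label.openTile_subset_halfOpenTile _ hp) hne⟩

lemma exists_minimalPeriod_of_mem_grid {p : Plane} (hp : p ∈ grid) :
    ∃ n : ℕ, minimalPeriod triMap p = 9 * n + 3 := by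
  obtain ⟨L, hL, hpL⟩ := Label.exists_mem_halfOpenTile p
  obtain ⟨c, hc⟩ := L.exists_energy_eq
  refine ⟨c, minimalPeriod_eq_of_ne_center hc hpL ?_⟩
  rintro rfl
  exact Label.openTile_subset_zeroFree _ (Label.center_mem_openTile hL) hp

end

theorem theoremB :
    -- (i) the critical set is the grid (with or without counting the line `y = 0` itself)
    (criticalSet (2 * π / 3) = grid ∧
      (⋃ i : ℕ, criticalLine (2 * π / 3) (i + 1)) = grid) ∧
    -- (ii) first integral, with values exactly the natural numbers
    (IsFirstIntegralOn (mapF (2 * π / 3)) zeroFree funV ∧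
      funV '' zeroFree = Set.range (fun c : ℕ => (c : ℝ))) ∧
    -- (ii.a) even levels: `6c + 2` triangles
    (∀ c : ℕ, Even c →
      LevelDescription (mapF (2 * π / 3)) c (6 * c + 2) 3 (2 * c) (3 * c + 1) 3 (9 * c + 3)) ∧
    -- (ii.b) odd levels: `3c + 1` hexagons
    (∀ c : ℕ, Odd c →
      LevelDescription (mapF (2 * π / 3)) c (3 * c + 1) 6 c (3 * c + 1) 3 (9 * c + 3)) ∧
    -- (iii) the critical set
    (∀ p ∈ criticalSet (2 * π / 3), ∃ n : ℕ, minimalPeriod (mapF (2 * π / 3)) p = 9 * n + 3) ∧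
    -- (iv) all points are periodic, and the set of periods
    IsPointwisePeriodic (mapF (2 * π / 3)) ∧
    setOfPeriods (mapF (2 * π / 3)) =
      {N | (∃ n : ℕ, N = 3 * n + 1) ∨ (∃ n : ℕ, N = 9 * n + 3)} := by
  refine ⟨⟨criticalSet_eq_grid, iUnion_criticalLine_succ⟩,
    ⟨isFirstIntegralOn_funV, funV_image_zeroFree⟩, ?_, ?_, ?_,
    isPointwisePeriodic_of_forall_mem_periodicPts mem_periodicPts_triMap, setOfPeriods_triMap⟩
  · rintro c ⟨n, rfl⟩
    rw [← two_mul]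
    exact (triLabel_isNecklaceLabelling n).levelDescription
  · rintro c ⟨n, rfl⟩
    exact (hexLabel_isNecklaceLabelling n).levelDescription
  · rw [criticalSet_eq_grid]
    exact fun p hp => exists_minimalPeriod_of_mem_grid hp
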